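/- Let $d\ge 1$, $\mathscr H=\ell^2(\mathbb Z^d)$, and $\kappa=(\kappa_j)_{j=1}^d$ with integers $\kappa_j\ge 1$. Let $(S_ju)(n)=u(n_1,\dots,n_j-1,\dots,n_d)$, let $(N_ju)(n)=n_ju(n)$, and put $$\Delta_j=\tfrac12(S_j+S_j^{-1}),\qquad \Delta=\sum_{j=1}^d\Delta_j,\qquad D=\prod_{j=1}^d\Delta_j,\qquad \frac{D}{\Delta_j}:=\prod_{i\ne j}\Delta_i .$$ Let $A_j$ be the closure in $\mathscr H$ of the operator $$\frac1{4i}\Big[(S_j^{\kappa_j}-S_j^{-\kappa_j})N_j+N_j(S_j^{\kappa_j}-S_j^{-\kappa_j})\Big]$$ on the finitely supported sequences $\ell_0(\mathbb Z^d)$, and let $A_\kappa$ be the self-adjoint operator obtained as the closure of $\sum_{j=1}^dA_j$ on $\ell_0(\mathbb Z^d)$. For a self-adjoint operator $A$ and a bounded self-adjoint operator $T$, write $T\in C^\infty(A)$ if for every $k\in\mathbb N$ the map $t\mapsto e^{itA}Te^{-itA}$ is of class $C^k(\mathbb R)$ for the strong operator topology. For a densely defined symmetric operator $A$ and a bounded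 self-adjoint operator $T$, write $[T,iA]_\circ$ for the bounded operator that extends the form $(\psi,\phi)\mapsto i\big(\langle T\psi,A\phi\rangle-\langle A\psi,T\phi\rangle\big)$ on $\mathrm{Dom}[A]\times\mathrm{Dom}[A]$, when such an operator exists. Let $U_n$ be the Chebyshev polynomials of the second kind: $U_0=1$, $U_1=2X$, $U_{n+1}=2XU_n-U_{n-1}$. Then $\Delta_j$ (for all $1\le j\le d$), $\Delta$ and $D$ belong to $C^\infty(A_\kappa)$. Moreover, the following bounded commutators exist and $$[\Delta,iA_\kappa]_\circ=\sum_{j=1}^d[\Delta_j,iA_j]_\circ=\sum_{j=1}^d(1-\Delta_j^2)\,U_{\kappa_j-1}(\Delta_j),$$ $$[D,iA_\kappa]_\circ=\sum_{j=1}^d\frac{D}{\Delta_j}[\Delta_j,iA_j]_\circ=\sum_{j=1}^d\frac{D}{\Delta_j}(1-\Delta_j^2)\,U_{\kappa_j-1}(\Delta_j),$$ where in fact $[\Delta_j,iA_j]_\circ=(1-\Delta_j^2)U_{\kappa_j-1}(\Delta_j)$ for each $j$. -/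

import Mathlib

open scoped InnerProductSpace

noncomputable section

/-! ### Unitary groups, regularity classes and commutators -/

section Abstract

variable {H : Type*} [NormedAddCommGroup H] [InnerProductSpace ℂ H] [CompleteSpace H]

/-- `U t = exp (i t A)`: the family `U` is a strongly continuous one-parameter unitary group whose
infinitesimal generator is exactly `i A` (same domain, same values).  By Stone's theorem such a
group exists if and only if `A` is self-adjoint, and it is then unique. -/
structure IsUnitaryGroupOf (A : H →ₗ.[ℂ] H) (U : ℝ → H →L[ℂ] H) : Prop where
  map_zero : U 0 = 1
  map_add : ∀ s t : ℝ, U (s + t) = U s * U t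
  mem_unitary : ∀ t : ℝ, U t ∈ unitary (H →L[ℂ] H)
  continuous : ∀ φ : H, Continuous fun t : ℝ => U t φ
  generator : ∀ φ ψ : H, HasDerivAt (fun t : ℝ => U t φ) ψ 0 ↔
    ∃ h : φ ∈ A.domain, ψ = Complex.I • A ⟨φ, h⟩

/-- `T ∈ C^k(A)`: the unitary group `exp (i t A)` exists and
`t ↦ exp (i t A) T exp (-i t A)` is of class `C^k` for the strong operator topology. -/
def IsOfClassC (k : ℕ) (A : H →ₗ.[ℂ] H) (T : H →L[ℂ] H) : Prop :=
  ∃ U : ℝ → H →L[ℂ] H, IsUnitaryGroupOf A U ∧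
    ∀ φ : H, ContDiff ℝ k fun t : ℝ => U t (T (U (-t) φ))

/-- `T ∈ C^∞(A)`. -/
def IsOfClassCInfty (A : H →ₗ.[ℂ] H) (T : H →L[ℂ] H) : Prop :=
  ∀ k : ℕ, IsOfClassC k A T

/-- `[T, iA]_∘ = B` for self-adjoint `T`: the sesquilinear form
`(ψ, φ) ↦ i (⟨T ψ, A φ⟩ - ⟨A ψ, T φ⟩)` on `Dom A × Dom A` extends to the bounded form of `B`. -/
def HasBoundedCommutator (T : H →L[ℂ] H) (A : H →ₗ.[ℂ] H) (B : H →L[ℂ] H) : Prop :=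
  ∀ ψ φ : A.domain, ⟪(ψ : H), B φ⟫_ℂ =
    Complex.I * (⟪T (ψ : H), A φ⟫_ℂ - ⟪A ψ, T (φ : H)⟫_ℂ)

end Abstract

/-! ### Operators on the lattice -/

/-- The Hilbert space `ℓ²(ℤ^d)`. -/
abbrev LatticeL2 (d : ℕ) : Type := lp (fun _ : Fin d → ℤ => ℂ) 2

theorem LatticeL2.memℓp_shift {d : ℕ} (v : Fin d → ℤ) (u : LatticeL2 d) :
    Memℓp (fun n : Fin d → ℤ => u (n - v)) 2 := by
  have h := (memℓp_gen_iff (p := 2) (by norm_num)).1 (lp.memℓp u)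
  exact (memℓp_gen_iff (p := 2) (by norm_num)).2 ((Equiv.subRight v).summable_iff.2 h)

/-- Translation by `v ∈ ℤ^d`: `(latticeShift v u)(n) = u (n - v)`. -/
def latticeShift {d : ℕ} (v : Fin d → ℤ) : LatticeL2 d →L[ℂ] LatticeL2 d :=
  LinearIsometry.toContinuousLinearMap
    { toFun := fun u => ⟨fun n => u (n - v), LatticeL2.memℓp_shift v u⟩
      map_add' := fun _ _ => rfl
      map_smul' := fun _ _ => rfl
      norm_map' := fun u => by
        rw [lp.norm_eq_tsum_rpow (p := 2) (by norm_num), lp.norm_eq_tsum_rpow (p := 2) (by norm_num)]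
        congr 1
        exact (Equiv.subRight v).tsum_eq fun n => ‖u n‖ ^ (2 : ENNReal).toReal }

@[simp] theorem latticeShift_apply {d : ℕ} (v : Fin d → ℤ) (u : LatticeL2 d) (n : Fin d → ℤ) :
    latticeShift v u n = u (n - v) := rfl

/-- The power `S_j ^ k`, `k ∈ ℤ`, of the shift to the right along the `j`-th coordinate:
`(S_j ^ k u)(n) = u (n_1, …, n_j - k, …, n_d)`. -/
def shift {d : ℕ} (j : Fin d) (k : ℤ) : LatticeL2 d →L[ℂ] LatticeL2 d :=
  latticeShift (Pi.single j k)

/-- `Δ_j = (S_j + S_j⁻¹) / 2`. -/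
def coordLaplacian {d : ℕ} (j : Fin d) : LatticeL2 d →L[ℂ] LatticeL2 d :=
  (1 / 2 : ℂ) • (shift j 1 + shift j (-1))

theorem latticeShift_commute {d : ℕ} (v w : Fin d → ℤ) : Commute (latticeShift v) (latticeShift w) := by
  ext u n
  change u (n - v - w) = u (n - w - v)
  rw [sub_right_comm]

theorem coordLaplacian_commute {d : ℕ} (i j : Fin d) :
    Commute (coordLaplacian i) (coordLaplacian j) := by
  have h : ∀ k l : ℤ, Commute (shift i k) (shift j l) := fun k l => latticeShift_commute _ _
  exact ((((h _ _).add_right (h _ _)).add_left ((h _ _).add_right (h _ _))).smul_left _).smul_right _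

/-- The standard Laplacian `Δ = ∑_j Δ_j`. -/
def stdLaplacian (d : ℕ) : LatticeL2 d →L[ℂ] LatticeL2 d :=
  ∑ j : Fin d, coordLaplacian j

/-- The product of the commuting operators `Δ_i`, `i ∈ s`. -/
def prodLaplacian {d : ℕ} (s : Finset (Fin d)) : LatticeL2 d →L[ℂ] LatticeL2 d :=
  s.noncommProd coordLaplacian fun i _ j _ _ => coordLaplacian_commute i j

/-- The Molchanov-Vainberg Laplacian `D = ∏_j Δ_j`. -/
def mvLaplacian (d : ℕ) : LatticeL2 d →L[ℂ] LatticeL2 d :=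
  prodLaplacian Finset.univ

/-- The bounded operator `D / Δ_j = ∏_{i ≠ j} Δ_i`. -/
def mvQuotient {d : ℕ} (j : Fin d) : LatticeL2 d →L[ℂ] LatticeL2 d :=
  prodLaplacian (Finset.univ.erase j)

theorem mvQuotient_mul_coordLaplacian {d : ℕ} (j : Fin d) :
    mvQuotient j * coordLaplacian j = mvLaplacian d :=
  Finset.noncommProd_erase_mul _ (Finset.mem_univ j) _
    fun i _ k _ _ => coordLaplacian_commute i k

/-! ### The conjugate operator -/

/-- `ℓ_0(ℤ^d)`: the sequences with finite support. -/
def finSupp (d : ℕ) : Submodule ℂ (LatticeL2 d) where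
  carrier := {u | (Function.support fun n => u n).Finite}
  zero_mem' := by simp [Function.support]
  add_mem' := fun {u v} hu hv => (hu.union hv).subset (Function.support_add (fun n => u n) fun n => v n)
  smul_mem' := fun c u hu => Set.Finite.subset hu (Function.support_const_smul_subset c fun n => u n)

theorem memℓp_two_of_finite_support {α : Type*} {f : α → ℂ} (hf : (Function.support f).Finite) :
    Memℓp f 2 :=
  (memℓp_zero hf).of_exponent_ge zero_le

theorem finSupp_mul {d : ℕ} (c : (Fin d → ℤ) → ℂ) (u : finSupp d) :
    (Function.support fun n => c n * u.1 n).Finite :=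
  Set.Finite.subset u.2 (Function.support_mul_subset_right c fun n => u.1 n)

/-- The position operator `N_j` on `ℓ_0(ℤ^d)`: `(N_j u)(n) = n_j u(n)`. -/
def position₀ {d : ℕ} (j : Fin d) : finSupp d →ₗ[ℂ] finSupp d where
  toFun u := ⟨⟨fun n => (n j : ℂ) * u.1 n,
    memℓp_two_of_finite_support (finSupp_mul (fun n => (n j : ℂ)) u)⟩,
    finSupp_mul (fun n => (n j : ℂ)) u⟩
  map_add' u v := by
    ext n
    exact mul_add _ _ _
  map_smul' c u := by
    ext n
    exact mul_left_comm _ _ _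

theorem shift_mem_finSupp {d : ℕ} (j : Fin d) (k : ℤ) (u : LatticeL2 d) (hu : u ∈ finSupp d) :
    shift j k u ∈ finSupp d :=
  Set.Finite.preimage (sub_left_injective (b := (Pi.single j k : Fin d → ℤ))).injOn hu

/-- `S_j ^ k` on `ℓ_0(ℤ^d)`. -/
def shift₀ {d : ℕ} (j : Fin d) (k : ℤ) : finSupp d →ₗ[ℂ] finSupp d :=
  (shift j k).toLinearMap.restrict (shift_mem_finSupp j k)

/-- The operator `(4i)⁻¹ [(S_j^k - S_j^{-k}) N_j + N_j (S_j^k - S_j^{-k})]` on `ℓ_0(ℤ^d)`. -/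
def dilation₀ {d : ℕ} (j : Fin d) (k : ℕ) : finSupp d →ₗ[ℂ] finSupp d :=
  (1 / (4 * Complex.I)) •
    ((shift₀ j k - shift₀ j (-k)) ∘ₗ position₀ j + position₀ j ∘ₗ (shift₀ j k - shift₀ j (-k)))

/-- `A_j`: the closure in `ℓ²(ℤ^d)` of the previous operator, with `k = κ_j`. -/
def coordDilation {d : ℕ} (κ : Fin d → ℕ) (j : Fin d) : LatticeL2 d →ₗ.[ℂ] LatticeL2 d :=
  LinearPMap.closure ⟨finSupp d, (finSupp d).subtype ∘ₗ dilation₀ j (κ j)⟩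

/-- `A_κ = ∑_j A_j`: the closure in `ℓ²(ℤ^d)` of the sum over `j`, defined on `ℓ_0(ℤ^d)`. -/
def dilation {d : ℕ} (κ : Fin d → ℕ) : LatticeL2 d →ₗ.[ℂ] LatticeL2 d :=
  LinearPMap.closure ⟨finSupp d, (finSupp d).subtype ∘ₗ ∑ j, dilation₀ j (κ j)⟩

/-- The bounded operator `(1 - Δ_j²) U_{k-1}(Δ_j)`, with `U` the Chebyshev polynomials of the
second kind. -/
def chebyshevLaplacian {d : ℕ} (j : Fin d) (k : ℕ) : LatticeL2 d →L[ℂ] LatticeL2 d :=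
  (1 - coordLaplacian j ^ 2) *
    Polynomial.aeval (coordLaplacian j) (Polynomial.Chebyshev.U ℂ ((k : ℤ) - 1))

end

/-! Write $A$ for $A_\kappa$ and $v_j=\kappa_je_j$. The proof has an analytic and an algebraic half.

Analytic half: the group $e^{itA}$ exists. A vector $u$ orthogonal to the range of $a-iA$ on
$\ell_0$ satisfies $a\,u(n)=\sum_j\big(b_j(n)u(n+v_j)-b_j(n-v_j)u(n-v_j)\big)$ with
$b_j(n)=(2n_j+\kappa_j)/4$. Pairing with $\bar u$ would give $0$ by antisymmetry, but $b_j$ grows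
linearly and the sums need not converge. With the weight $w=(1+|n|_1)^{-1}$ they do, and summation
by parts leaves $(w(n)-w(n+v_j))b_j(n)=O(w)$. Hence $|a|\sum w|u|^2\le C\sum w|u|^2$, so $u=0$ once
$|a|>C$ (`eq_zero_of_eq_sum_shift`). The closure then has resolvents at all large real $\pm a$, and
a Yosida approximation produces the group with the exact generator (`exists_isUnitaryGroupOf`).

Algebraic half: on $\ell_0$ the commutator of $\Delta_i$ with the $j$-th summand vanishes for $i\ne
j$. For $i=j$ it is a product of shift differences, which the identity
$\sin\theta\,U_{k-1}(\cos\theta)=\sin k\theta$ turns into a polynomial in $\Delta_j$. So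
$T\mapsto[T,iA]$ is a derivation preserving the algebra generated by the $\Delta_j$. Since
$\frac{d}{dt}e^{itA}Te^{-itA}=-e^{itA}[T,iA]e^{-itA}$ strongly, iteration gives $C^\infty(A)$, and
the Leibniz rule gives the formulas for $\Delta$ and $D$. -/

section Resolvents

/-! ### Bounded resolvents of symmetric operators and exponentials of skew-adjoint ones. -/

open Filter Topology

variable {H : Type*} [NormedAddCommGroup H] [InnerProductSpace ℂ H]

/-! ### Convergence on a dense set -/

theorem tendsto_of_tendsto_on_dense {ι : Type*} {l : Filter ι} {T : ι → H →L[ℂ] H}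
    (hT : ∀ i x, ‖T i x‖ ≤ ‖x‖) (S : H →L[ℂ] H) (hS : ∀ x, ‖S x‖ ≤ ‖x‖) {D : Set H} (hD : Dense D)
    (h : ∀ x ∈ D, Tendsto (fun i => T i x) l (𝓝 (S x))) (x : H) :
    Tendsto (fun i => T i x) l (𝓝 (S x)) := by
  rw [Metric.tendsto_nhds]
  intro ε hε
  obtain ⟨y, hy, hxy⟩ := Metric.dense_iff.1 hD x (ε / 3) (by positivity)
  rw [Metric.mem_ball, dist_comm, dist_eq_norm] at hy
  filter_upwards [Metric.tendsto_nhds.1 (h y hxy) (ε / 3) (by positivity)] with i hi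
  rw [dist_eq_norm] at hi ⊢
  have e : T i x - S x = T i (x - y) + (T i y - S y) - S (x - y) := by
    simp only [map_sub]; abel
  rw [e]
  calc _ ≤ ‖T i (x - y)‖ + ‖T i y - S y‖ + ‖S (x - y)‖ :=
        (norm_sub_le _ _).trans (add_le_add_left (norm_add_le _ _) _)
    _ < ε := by linarith [hT i (x - y), hS (x - y)]

theorem cauchySeq_of_cauchySeq_on_dense {T : ℕ → H →L[ℂ] H}
    (hT : ∀ i x, ‖T i x‖ ≤ ‖x‖) {D : Set H} (hD : Dense D)
    (h : ∀ x ∈ D, CauchySeq fun i => T i x) (x : H) : CauchySeq fun i => T i x := by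
  rw [Metric.cauchySeq_iff]
  intro ε hε
  obtain ⟨y, hy, hxy⟩ := Metric.dense_iff.1 hD x (ε / 3) (by positivity)
  rw [Metric.mem_ball, dist_comm, dist_eq_norm] at hy
  obtain ⟨N, hN⟩ := Metric.cauchySeq_iff.1 (h y hxy) (ε / 3) (by positivity)
  refine ⟨N, fun m hm n hn => ?_⟩
  have hi := hN m hm n hn
  rw [dist_eq_norm] at hi ⊢
  have e : T m x - T n x = T m (x - y) + (T m y - T n y) - T n (x - y) := by
    simp only [map_sub]; abel
  rw [e]
  calc _ ≤ ‖T m (x - y)‖ + ‖T m y - T n y‖ + ‖T n (x - y)‖ :=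
        (norm_sub_le _ _).trans (add_le_add_left (norm_add_le _ _) _)
    _ < ε := by linarith [hT m (x - y), hT n (x - y)]

/-! ### Resolvents of symmetric operators -/

variable {A : H →ₗ.[ℂ] H}

/-- By symmetry $\langle x,Ax\rangle$ is real, so $\mathrm{Re}\langle x,(a-iA)x\rangle=a\|x\|^2$;
then Cauchy–Schwarz. -/
theorem norm_le_norm_resolvent (hA : A.IsFormalAdjoint A) (a : ℝ) (x : A.domain) :
    |a| * ‖(x : H)‖ ≤ ‖(a : ℂ) • (x : H) - Complex.I • A x‖ := by
  have him : (⟪(x : H), A x⟫_ℂ).im = 0 := by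
    have h := hA x x
    rw [← inner_conj_symm] at h
    exact Complex.conj_eq_iff_im.1 h
  have hre : (⟪(x : H), (a : ℂ) • (x : H) - Complex.I • A x⟫_ℂ).re = a * ‖(x : H)‖ ^ 2 := by
    rw [inner_sub_right, inner_smul_right, inner_smul_right, inner_self_eq_norm_sq_to_K]
    simp [him, ← Complex.ofReal_pow]
  have h1 : |a| * ‖(x : H)‖ ^ 2 ≤ ‖(x : H)‖ * ‖(a : ℂ) • (x : H) - Complex.I • A x‖ := by
    rw [← abs_of_nonneg (sq_nonneg ‖(x : H)‖), ← abs_mul, ← hre]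
    exact (Complex.abs_re_le_norm _).trans (norm_inner_le_norm _ _)
  rcases (norm_nonneg (x : H)).eq_or_lt with h0 | h0
  · rw [← h0, mul_zero]; exact norm_nonneg _
  · refine le_of_mul_le_mul_left ?_ h0
    linarith [h1]

/-- `R` is the bounded inverse of `a - i A`. -/
structure IsResolvent (A : H →ₗ.[ℂ] H) (a : ℝ) (R : H →L[ℂ] H) : Prop where
  right_inv : ∀ y, ∃ h : R y ∈ A.domain, (a : ℂ) • R y - Complex.I • A ⟨R y, h⟩ = y
  left_inv : ∀ x : A.domain, R ((a : ℂ) • (x : H) - Complex.I • A x) = x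
  norm_le : ∀ y, |a| * ‖R y‖ ≤ ‖y‖

theorem exists_isResolvent (hA : A.IsFormalAdjoint A) {a : ℝ} (ha : a ≠ 0)
    (hs : ∀ y, ∃ x : A.domain, (a : ℂ) • (x : H) - Complex.I • A x = y) :
    ∃ R, IsResolvent A a R := by
  let L : A.domain →ₗ[ℂ] H := (a : ℂ) • A.domain.subtype - Complex.I • A.toFun
  have hL : ∀ x : A.domain, L x = (a : ℂ) • (x : H) - Complex.I • A x := fun x => rfl
  have hinj : Function.Injective L := by
    rw [← LinearMap.ker_eq_bot, LinearMap.ker_eq_bot']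
    intro x hx
    have h := norm_le_norm_resolvent hA a x
    rw [← hL, hx, norm_zero] at h
    have : ‖(x : H)‖ = 0 :=
      le_antisymm (nonpos_of_mul_nonpos_right h (abs_pos.2 ha)) (norm_nonneg _)
    exact Subtype.ext (norm_eq_zero.1 this)
  let e := LinearEquiv.ofBijective L ⟨hinj, hs⟩
  have he : ∀ y, L (e.symm y) = y := fun y => e.apply_symm_apply y
  have hb : ∀ y, |a| * ‖(e.symm y : H)‖ ≤ ‖y‖ := fun y => by
    have h := norm_le_norm_resolvent hA a (e.symm y)
    rwa [← hL, he] at h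
  refine ⟨(A.domain.subtype ∘ₗ e.symm.toLinearMap).mkContinuous |a|⁻¹ fun y => ?_,
    fun y => ⟨(e.symm y).2, ?_⟩, fun x => ?_, hb⟩
  · rw [inv_mul_eq_div, le_div_iff₀ (abs_pos.2 ha), mul_comm]
    exact hb y
  · exact he y
  · change ((e.symm (L x) : A.domain) : H) = x
    exact congrArg _ (e.symm_apply_apply x)

namespace IsResolvent

variable {a b : ℝ} {R S : H →L[ℂ] H}

/-- First resolvent identity: $(a-iA)Sy$ and $(b-iA)Sy=y$ differ by $(a-b)Sy$; apply $R$. -/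
theorem sub_eq (hR : IsResolvent A a R) (hS : IsResolvent A b S) :
    R - S = ((b - a : ℝ) : ℂ) • (R * S) := by
  ext y
  obtain ⟨h, hy⟩ := hS.right_inv y
  have h1 := hR.left_inv ⟨S y, h⟩
  have h2 : R y = R ((b : ℂ) • S y - Complex.I • A ⟨S y, h⟩) := by rw [hy]
  change R y - S y = ((b - a : ℝ) : ℂ) • R (S y)
  simp only [map_sub, map_smul] at h1 h2
  rw [h2]
  nth_rw 3 [← h1]
  push_cast
  module

theorem commute (hR : IsResolvent A a R) (hS : IsResolvent A b S) : Commute R S := by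
  by_cases hab : a = b
  · have h := hR.sub_eq hS
    rw [hab, sub_self, Complex.ofReal_zero, zero_smul, sub_eq_zero] at h
    rw [h]
  · have h1 := hR.sub_eq hS
    have h2 := hS.sub_eq hR
    have h3 : ((b - a : ℝ) : ℂ) • (R * S) = ((b - a : ℝ) : ℂ) • (S * R) := by
      rw [← h1, ← neg_sub S R, h2, ← neg_smul]
      push_cast
      congr 1
      ring
    have h0 : ((b - a : ℝ) : ℂ) ≠ 0 := by
      exact_mod_cast sub_ne_zero.2 (Ne.symm hab)
    exact smul_right_injective _ h0 h3

theorem adjoint_eq [CompleteSpace H] (hA : A.IsFormalAdjoint A) (hR : IsResolvent A a R)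
    (hS : IsResolvent A (-a) S) : ContinuousLinearMap.adjoint R = -S := by
  symm
  rw [ContinuousLinearMap.eq_adjoint_iff]
  intro x y
  obtain ⟨hx, hx'⟩ := hS.right_inv x
  obtain ⟨hy, hy'⟩ := hR.right_inv y
  have h := hA ⟨S x, hx⟩ ⟨R y, hy⟩
  conv_lhs => rw [← hy']
  conv_rhs => rw [← hx']
  simp only [neg_apply, inner_neg_left, inner_sub_left, inner_sub_right,
    inner_smul_left, inner_smul_right, Complex.conj_I, Complex.ofReal_neg, map_neg,
    Complex.conj_ofReal]
  simp only at h
  rw [h]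
  ring

end IsResolvent

/-! ### Exponentials of bounded skew-adjoint operators -/

variable [CompleteSpace H]

theorem norm_apply_of_mem_unitary {V : H →L[ℂ] H} (hV : V ∈ unitary (H →L[ℂ] H)) (x : H) :
    ‖V x‖ = ‖x‖ := by
  have h := congrArg (fun W : H →L[ℂ] H => ⟪W x, x⟫_ℂ) (Unitary.mem_iff.1 hV).1
  simp only [ContinuousLinearMap.star_eq_adjoint, mul_apply_eq_comp,
    ContinuousLinearMap.adjoint_inner_left, one_apply_eq_self,
    inner_self_eq_norm_sq_to_K] at h
  have h' : ‖V x‖ ^ 2 = ‖x‖ ^ 2 := by exact_mod_cast h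
  exact (sq_eq_sq₀ (norm_nonneg _) (norm_nonneg _)).1 h'

theorem exp_smul_mem_unitary {K : H →L[ℂ] H} (hK : K ∈ skewAdjoint (H →L[ℂ] H)) (t : ℝ) :
    NormedSpace.exp (t • K) ∈ unitary (H →L[ℂ] H) := by
  let +nondep : NormedAlgebra ℚ (H →L[ℂ] H) := .restrictScalars ℚ ℂ _
  refine NormedSpace.exp_mem_unitary_of_mem_skewAdjoint ?_
  rw [skewAdjoint.mem_iff] at hK ⊢
  rw [star_smul, hK, star_trivial, smul_neg]

theorem hasDerivAt_exp_smul_apply (K : H →L[ℂ] H) (x : H) (t : ℝ) :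
    HasDerivAt (fun s : ℝ => NormedSpace.exp (s • K) x) (NormedSpace.exp (t • K) (K x)) t :=
  ((ContinuousLinearMap.apply ℂ H x).restrictScalars ℝ).hasFDerivAt.comp_hasDerivAt t
    (hasDerivAt_exp_smul_const (𝕂 := ℝ) K t)

theorem norm_exp_smul_apply_sub_le {K : H →L[ℂ] H} (hK : K ∈ skewAdjoint (H →L[ℂ] H))
    (x : H) (t : ℝ) : ‖NormedSpace.exp (t • K) x - x‖ ≤ |t| * ‖K x‖ := by
  have h := convex_univ.norm_image_sub_le_of_norm_hasDerivWithin_le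
    (f := fun s : ℝ => NormedSpace.exp (s • K) x) (C := ‖K x‖) (x := 0) (y := t)
    (fun s _ => (hasDerivAt_exp_smul_apply K x s).hasDerivWithinAt)
    (fun s _ => (norm_apply_of_mem_unitary (exp_smul_mem_unitary hK s) _).le)
    (Set.mem_univ _) (Set.mem_univ _)
  simpa [mul_comm] using h

/-- Commutation allows factoring out the unitary $e^{tL}$, which leaves $e^{t(K-L)}x-x$, estimated
by the mean value inequality. -/
theorem norm_exp_smul_sub_exp_smul_le {K L : H →L[ℂ] H} (hK : K ∈ skewAdjoint (H →L[ℂ] H))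
    (hL : L ∈ skewAdjoint (H →L[ℂ] H)) (hKL : Commute K L) (x : H) (t : ℝ) :
    ‖NormedSpace.exp (t • K) x - NormedSpace.exp (t • L) x‖ ≤ |t| * ‖K x - L x‖ := by
  let +nondep : NormedAlgebra ℚ (H →L[ℂ] H) := .restrictScalars ℚ ℂ _
  have hc : Commute (t • L) (t • (K - L)) :=
    ((hKL.symm.sub_right (Commute.refl L)).smul_left t).smul_right t
  have h : NormedSpace.exp (t • K) = NormedSpace.exp (t • L) * NormedSpace.exp (t • (K - L)) := by
    rw [← NormedSpace.exp_add_of_commute hc]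
    congr 1
    module
  rw [h, mul_apply_eq_comp, ← map_sub,
    norm_apply_of_mem_unitary (exp_smul_mem_unitary hL t)]
  exact norm_exp_smul_apply_sub_le ((skewAdjoint _).sub_mem hK hL) x t

end Resolvents

/-! ### The unitary group generated by a symmetric operator with large real resolvents. -/

section Generation

open Filter Topology

variable {H : Type*} [NormedAddCommGroup H] [InnerProductSpace ℂ H]

/-! ### Yosida approximation and the unitary group -/

/-- `K n` are commuting bounded skew-adjoint operators converging to `i A` on the domain of `A`. -/
structure IsSkewApproximation [CompleteSpace H] (A : H →ₗ.[ℂ] H) (K : ℕ → H →L[ℂ] H) : Prop where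
  mem_skewAdjoint : ∀ n, K n ∈ skewAdjoint (H →L[ℂ] H)
  commute : ∀ m n, Commute (K m) (K n)
  tendsto : ∀ x : A.domain, Tendsto (fun n => K n x) atTop (𝓝 (Complex.I • A x))

variable {A : H →ₗ.[ℂ] H}

theorem IsResolvent.smul_apply_sub {a : ℝ} {R : H →L[ℂ] H} (hR : IsResolvent A a R)
    (x : A.domain) : (a : ℂ) • R x - x = R (Complex.I • A x) := by
  have h := hR.left_inv x
  rw [map_sub, map_smul] at h
  nth_rw 2 [← h]
  abel

theorem IsResolvent.norm_smul_apply_le {a : ℝ} {R : H →L[ℂ] H} (hR : IsResolvent A a R) (y : H) :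
    ‖((a : ℂ) • R) y‖ ≤ ‖y‖ := by
  rw [smul_apply, norm_smul, Complex.norm_real, Real.norm_eq_abs]
  exact hR.norm_le y

/-- On the domain, $aR(a)x-x=R(a)(iAx)$ has norm at most $\|Ax\|/|a|$; contractivity of $aR(a)$
extends the limit by density. -/
theorem tendsto_smul_resolvent (hd : Dense (A.domain : Set H)) {a : ℕ → ℝ}
    (ha : Tendsto (fun n => |a n|) atTop atTop) {R : ℕ → H →L[ℂ] H}
    (hR : ∀ n, IsResolvent A (a n) (R n)) (y : H) :
    Tendsto (fun n => (a n : ℂ) • R n y) atTop (𝓝 y) := by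
  refine tendsto_of_tendsto_on_dense (T := fun n => (a n : ℂ) • R n)
    (fun n => (hR n).norm_smul_apply_le) (ContinuousLinearMap.id ℂ H) (fun x => le_rfl) hd
    (fun x hx => ?_) y
  rw [tendsto_iff_norm_sub_tendsto_zero]
  have h0 : Tendsto (fun n => ‖Complex.I • A ⟨x, hx⟩‖ / |a n|) atTop (𝓝 0) :=
    ha.const_div_atTop _
  refine squeeze_zero' (Eventually.of_forall fun n => norm_nonneg _) ?_ h0
  filter_upwards [ha.eventually_gt_atTop 0] with n hn
  rw [le_div_iff₀ hn, mul_comm]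
  have h := (hR n).smul_apply_sub ⟨x, hx⟩
  change |a n| * ‖(a n : ℂ) • R n x - x‖ ≤ _
  rw [h]
  exact (hR n).norm_le _

theorem exists_isSkewApproximation [CompleteSpace H] (hd : Dense (A.domain : Set H))
    (hA : A.IsFormalAdjoint A) (C : ℝ)
    (hs : ∀ a : ℝ, C ≤ |a| → ∀ y, ∃ x : A.domain, (a : ℂ) • (x : H) - Complex.I • A x = y) :
    ∃ K, IsSkewApproximation A K := by
  let a : ℕ → ℝ := fun n => |C| + n + 1
  have ha0 : ∀ n, 0 < a n := fun n => by positivity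
  have haC : ∀ n, C ≤ |a n| := fun n => by
    rw [abs_of_pos (ha0 n)]
    have := le_abs_self C
    have : (0 : ℝ) ≤ n := n.cast_nonneg
    simp only [a]; linarith
  have hat : Tendsto a atTop atTop :=
    tendsto_atTop_add_const_right _ _ (tendsto_atTop_add_const_left _ _ tendsto_natCast_atTop_atTop)
  have hat' : Tendsto (fun n => |a n|) atTop atTop := tendsto_abs_atTop_atTop.comp hat
  choose R hR using fun n => exists_isResolvent hA (ha0 n).ne' (hs (a n) (haC n))
  choose S hS using fun n => exists_isResolvent hA (neg_ne_zero.2 (ha0 n).ne')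
    (hs (-a n) (by rw [abs_neg]; exact haC n))
  -- Symmetrised Yosida approximation, formally $a^2B(a^2-B^2)^{-1}$ with $B=iA$. It is skew-adjoint
  -- because $R^*=-S$, and on the domain it equals $\tfrac12(aR-aS)(iAx)$.
  refine ⟨fun n => ((a n ^ 2 / 2 : ℝ) : ℂ) • (R n + S n), fun n => ?_, fun m n => ?_, fun x => ?_⟩
  · have h1 := (hR n).adjoint_eq hA (hS n)
    have h2 : ContinuousLinearMap.adjoint (S n) = -R n := by
      rw [← neg_eq_iff_eq_neg.2 h1, map_neg, ContinuousLinearMap.adjoint_adjoint]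
    rw [skewAdjoint.mem_iff, star_smul, star_add, ContinuousLinearMap.star_eq_adjoint,
      ContinuousLinearMap.star_eq_adjoint, h1, h2, Complex.star_def, Complex.conj_ofReal]
    module
  · have h1 : ∀ T, IsResolvent A (a m) T ∨ IsResolvent A (-a m) T → Commute T (R n + S n) := by
      rintro T (h | h) <;> exact (h.commute (hR n)).add_right (h.commute (hS n))
    exact (((h1 _ (.inl (hR m))).add_left (h1 _ (.inr (hS m)))).smul_left _).smul_right _
  · have h1 := tendsto_smul_resolvent hd hat' hR (Complex.I • A x)
    have h2 := tendsto_smul_resolvent hd (by simpa only [abs_neg] using hat') hS (Complex.I • A x)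
    have h3 := (h1.add h2).const_smul (1 / 2 : ℂ)
    rw [← two_smul ℂ, smul_smul, show (1 / 2 : ℂ) * 2 = 1 by norm_num, one_smul] at h3
    refine h3.congr fun n => ?_
    rw [← (hR n).smul_apply_sub, ← (hS n).smul_apply_sub]
    simp only [smul_apply, add_apply]
    push_cast
    module

namespace IsSkewApproximation

variable [CompleteSpace H] {K : ℕ → H →L[ℂ] H}

theorem norm_exp_apply (hK : IsSkewApproximation A K) (t : ℝ) (n : ℕ) (x : H) :
    ‖NormedSpace.exp (t • K n) x‖ = ‖x‖ :=
  norm_apply_of_mem_unitary (exp_smul_mem_unitary (hK.mem_skewAdjoint n) t) x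

/-- For $x$ in the domain, $\|e^{tK_m}x-e^{tK_n}x\|\le|t|\,\|K_mx-K_nx\|$ makes the sequence Cauchy;
isometry and density give all $x$. -/
theorem exists_tendsto_exp (hK : IsSkewApproximation A K) (hd : Dense (A.domain : Set H)) (t : ℝ) :
    ∃ V : H →L[ℂ] H, ∀ x, Tendsto (fun n => NormedSpace.exp (t • K n) x) atTop (𝓝 (V x)) := by
  have h : ∀ x, CauchySeq fun n => NormedSpace.exp (t • K n) x := by
    refine cauchySeq_of_cauchySeq_on_dense (fun n x => (hK.norm_exp_apply t n x).le) hd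
      fun x hx => ?_
    rw [Metric.cauchySeq_iff]
    intro ε hε
    obtain ⟨N, hN⟩ := Metric.cauchySeq_iff.1 (hK.tendsto ⟨x, hx⟩).cauchySeq (ε / (|t| + 1))
      (by positivity)
    refine ⟨N, fun m hm n hn => ?_⟩
    have h1 := hN m hm n hn
    rw [dist_eq_norm, lt_div_iff₀ (by positivity)] at h1
    rw [dist_eq_norm]
    refine (norm_exp_smul_sub_exp_smul_le (hK.mem_skewAdjoint m) (hK.mem_skewAdjoint n)
      (hK.commute m n) x t).trans_lt ?_
    simp only at h1
    nlinarith [norm_nonneg (K m x - K n x)]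
  choose f hf using fun x => cauchySeq_tendsto_of_complete (h x)
  exact ⟨continuousLinearMapOfTendsto (fun n => NormedSpace.exp (t • K n)) (tendsto_pi_nhds.2 hf),
    hf⟩

/-- The strong limit of `exp (t K n)`. -/
noncomputable def group (hK : IsSkewApproximation A K) (hd : Dense (A.domain : Set H)) (t : ℝ) : H →L[ℂ] H :=
  (hK.exists_tendsto_exp hd t).choose

variable (hK : IsSkewApproximation A K) (hd : Dense (A.domain : Set H))

theorem tendsto_group (t : ℝ) (x : H) :
    Tendsto (fun n => NormedSpace.exp (t • K n) x) atTop (𝓝 (hK.group hd t x)) :=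
  (hK.exists_tendsto_exp hd t).choose_spec x

theorem norm_group_apply (t : ℝ) (x : H) : ‖hK.group hd t x‖ = ‖x‖ :=
  tendsto_nhds_unique (hK.tendsto_group hd t x).norm
    (by simp only [hK.norm_exp_apply, tendsto_const_nhds])

theorem group_zero : hK.group hd 0 = 1 := by
  ext x
  refine tendsto_nhds_unique (hK.tendsto_group hd 0 x) ?_
  simp only [zero_smul, NormedSpace.exp_zero]
  exact tendsto_const_nhds

theorem group_add (s t : ℝ) : hK.group hd (s + t) = hK.group hd s * hK.group hd t := by
  let +nondep : NormedAlgebra ℚ (H →L[ℂ] H) := .restrictScalars ℚ ℂ _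
  ext x
  refine tendsto_nhds_unique (hK.tendsto_group hd (s + t) x) ?_
  have h1 : Tendsto (fun n => NormedSpace.exp (s • K n)
      (NormedSpace.exp (t • K n) x - hK.group hd t x)) atTop (𝓝 0) := by
    rw [tendsto_zero_iff_norm_tendsto_zero]
    simp only [hK.norm_exp_apply]
    exact tendsto_iff_norm_sub_tendsto_zero.1 (hK.tendsto_group hd t x)
  have h2 := h1.add (hK.tendsto_group hd s (hK.group hd t x))
  rw [zero_add] at h2
  refine h2.congr fun n => ?_
  rw [add_smul, NormedSpace.exp_add_of_commute (((Commute.refl (K n)).smul_left s).smul_right t),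
    map_sub, sub_add_cancel]
  rfl

theorem adjoint_group (t : ℝ) :
    ContinuousLinearMap.adjoint (hK.group hd t) = hK.group hd (-t) := by
  symm
  rw [ContinuousLinearMap.eq_adjoint_iff]
  intro x y
  refine tendsto_nhds_unique ((hK.tendsto_group hd (-t) x).inner tendsto_const_nhds)
    ((tendsto_const_nhds.inner (hK.tendsto_group hd t y)).congr fun n => ?_)
  rw [← ContinuousLinearMap.adjoint_inner_left, ← ContinuousLinearMap.star_eq_adjoint,
    NormedSpace.star_exp, star_smul, skewAdjoint.mem_iff.1 (hK.mem_skewAdjoint n), star_trivial,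
    smul_neg, neg_smul]

theorem group_mem_unitary (t : ℝ) : hK.group hd t ∈ unitary (H →L[ℂ] H) := by
  rw [Unitary.mem_iff, ContinuousLinearMap.star_eq_adjoint, adjoint_group, ← group_add, ← group_add,
    neg_add_cancel, add_neg_cancel, group_zero, and_self_iff]

theorem norm_group_sub_exp_le (t : ℝ) (n : ℕ) (x : A.domain) :
    ‖hK.group hd t x - NormedSpace.exp (t • K n) (x : H)‖ ≤ |t| * ‖Complex.I • A x - K n x‖ :=
  le_of_tendsto_of_tendsto'
    ((hK.tendsto_group hd t x).sub_const (NormedSpace.exp (t • K n) (x : H))).norm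
    (((hK.tendsto x).sub_const (K n x)).norm.const_mul |t|)
    fun m => norm_exp_smul_sub_exp_smul_le (hK.mem_skewAdjoint m) (hK.mem_skewAdjoint n)
      (hK.commute m n) x t

/-- The group differs from $e^{tK_n}$ at $x$ by at most $|t|\,\|iAx-K_nx\|$, linear in $|t|$. One
fixed $n$ therefore suffices, and the derivative of $e^{tK_n}x$ does the rest. -/
theorem hasDerivAt_group_zero (x : A.domain) :
    HasDerivAt (fun t : ℝ => hK.group hd t x) (Complex.I • A x) 0 := by
  rw [hasDerivAt_iff_isLittleO, Asymptotics.isLittleO_iff]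
  intro ε hε
  obtain ⟨n, hn⟩ := (Metric.tendsto_nhds.1 (hK.tendsto x) (ε / 3) (by positivity)).exists
  have h1 := Asymptotics.isLittleO_iff.1
    (hasDerivAt_iff_isLittleO.1 (hasDerivAt_exp_smul_apply (K n) x 0))
    (show 0 < ε / 3 by positivity)
  filter_upwards [h1] with t ht
  have h2 := hK.norm_group_sub_exp_le hd t n x
  rw [dist_comm, dist_eq_norm] at hn
  simp only [zero_smul, NormedSpace.exp_zero, one_apply_eq_self, sub_zero,
    group_zero, Real.norm_eq_abs] at ht ⊢
  have e : hK.group hd t x - x - t • Complex.I • A x =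
      (hK.group hd t x - NormedSpace.exp (t • K n) (x : H)) +
      (NormedSpace.exp (t • K n) (x : H) - x - t • K n x) - t • (Complex.I • A x - K n x) := by
    rw [smul_sub]; abel
  rw [e]
  calc _ ≤ ‖hK.group hd t x - NormedSpace.exp (t • K n) (x : H)‖ +
        ‖NormedSpace.exp (t • K n) (x : H) - x - t • K n x‖ +
        ‖t • (Complex.I • A x - K n x)‖ :=
        (norm_sub_le _ _).trans (add_le_add_left (norm_add_le _ _) _)
    _ ≤ ε * |t| := by
      rw [norm_smul, Real.norm_eq_abs]
      nlinarith [abs_nonneg t]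

theorem continuous_group (x : H) : Continuous fun t : ℝ => hK.group hd t x := by
  rw [continuous_iff_continuousAt]
  intro s
  refine tendsto_of_tendsto_on_dense (fun t x => (hK.norm_group_apply hd t x).le) (hK.group hd s)
    (fun x => (hK.norm_group_apply hd s x).le) hd (fun y hy => ?_) x
  have h1 : ContinuousAt (fun t : ℝ => hK.group hd t y) 0 :=
    (hK.hasDerivAt_group_zero hd ⟨y, hy⟩).continuousAt
  have h2 : ContinuousAt (fun t : ℝ => hK.group hd (t - s) y) s :=
    ContinuousAt.comp (g := fun t : ℝ => hK.group hd t y) (by rwa [sub_self]) (by fun_prop)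
  refine ((hK.group hd s).continuous.continuousAt.comp h2 |>.tendsto.congr fun t => ?_).trans
    (by simp [group_zero])
  change (hK.group hd s * hK.group hd (t - s)) y = _
  rw [← group_add, add_sub_cancel]

end IsSkewApproximation

theorem exists_isUnitaryGroupOf [CompleteSpace H] (hd : Dense (A.domain : Set H))
    (hA : A.IsFormalAdjoint A) (C : ℝ)
    (hs : ∀ a : ℝ, C ≤ |a| → ∀ y, ∃ x : A.domain, (a : ℂ) • (x : H) - Complex.I • A x = y) :
    ∃ U, IsUnitaryGroupOf A U := by
  obtain ⟨K, hK⟩ := exists_isSkewApproximation hd hA C hs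
  refine ⟨hK.group hd, hK.group_zero hd, hK.group_add hd, hK.group_mem_unitary hd,
    hK.continuous_group hd, fun φ ψ => ⟨fun h => ?_, ?_⟩⟩
  -- The generator is no larger than $iA$: with $c=|C|+1$, solve $(c-iA)x=c\varphi-\psi$ and show
  -- that $z=x-\varphi$ vanishes.
  · obtain ⟨x, hx⟩ := hs (|C| + 1)
      (by rw [abs_of_nonneg (by positivity)]; linarith [le_abs_self C])
      (((|C| + 1 : ℝ) : ℂ) • φ - ψ)
    set z : H := x - φ with hz
    have hz' : HasDerivAt (fun t : ℝ => hK.group hd t z) ((|C| + 1) • z) 0 := by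
      have h1 := (hK.hasDerivAt_group_zero hd x).sub h
      have h2 : Complex.I • A x - ψ = (|C| + 1) • z := by
        rw [← Complex.coe_smul, hz, smul_sub, sub_eq_iff_eq_add.1 hx]
        abel
      rw [h2] at h1
      refine h1.congr_of_eventuallyEq (Eventually.of_forall fun t => ?_)
      simp [hz]
    -- The orbit of $z$ has constant norm, yet its squared norm has derivative $2c\|z\|^2$ at $0$.
    have h3 := hz'.inner ℂ hz'
    simp only [inner_self_eq_norm_sq_to_K, hK.norm_group_apply, hK.group_zero,
      one_apply_eq_self] at h3
    have h4 := h3.unique (hasDerivAt_const _ _)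
    rw [← Complex.coe_smul, inner_smul_left, inner_smul_right, Complex.conj_ofReal,
      inner_self_eq_norm_sq_to_K, ← two_mul] at h4
    have h5 : z = 0 := by
      have h6 : ((|C| : ℝ) : ℂ) + 1 ≠ 0 := by
        exact_mod_cast (show |C| + 1 ≠ 0 by positivity)
      simpa [h6] using h4
    have h6 : φ = x := (sub_eq_zero.1 (hz ▸ h5)).symm
    subst h6
    exact ⟨x.2, h.unique (hK.hasDerivAt_group_zero hd x)⟩
  · rintro ⟨h, rfl⟩
    exact hK.hasDerivAt_group_zero hd ⟨φ, h⟩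

end Generation

/-! ### Domain commutators, smoothness of conjugation, closures of symmetric operators. -/

section Regularity

open Filter Topology

variable {H : Type*} [NormedAddCommGroup H] [InnerProductSpace ℂ H]

/-! ### Commutators in the operator sense -/

/-- `T` preserves the domain of `A`, and `[T, iA] = B` there. -/
def HasDomainCommutator (T : H →L[ℂ] H) (A : H →ₗ.[ℂ] H) (B : H →L[ℂ] H) : Prop :=
  ∀ x : A.domain, ∃ h : T x ∈ A.domain, A ⟨T x, h⟩ = T (A x) + Complex.I • B x

namespace HasDomainCommutator

variable {A : H →ₗ.[ℂ] H} {T S B B' : H →L[ℂ] H}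

theorem algebraMap_left (c : ℂ) : HasDomainCommutator (algebraMap ℂ (H →L[ℂ] H) c) A 0 := by
  intro x
  have e : algebraMap ℂ (H →L[ℂ] H) c x = ((c • x : A.domain) : H) := rfl
  refine ⟨e ▸ (c • x).2, ?_⟩
  change A (c • x) = c • A x + Complex.I • (0 : H)
  rw [A.map_smul, smul_zero, add_zero]

theorem add (hT : HasDomainCommutator T A B) (hS : HasDomainCommutator S A B') :
    HasDomainCommutator (T + S) A (B + B') := by
  intro x
  obtain ⟨h1, e1⟩ := hT x
  obtain ⟨h2, e2⟩ := hS x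
  refine ⟨A.domain.add_mem h1 h2, ?_⟩
  have e := A.map_add ⟨T x, h1⟩ ⟨S x, h2⟩
  refine e.trans ?_
  rw [e1, e2]
  simp only [add_apply, smul_add]
  abel

theorem sum {ι : Type*} {s : Finset ι} {T B : ι → H →L[ℂ] H}
    (h : ∀ i ∈ s, HasDomainCommutator (T i) A (B i)) :
    HasDomainCommutator (∑ i ∈ s, T i) A (∑ i ∈ s, B i) := by
  induction s using Finset.cons_induction with
  | empty => simpa using algebraMap_left (A := A) 0
  | cons a s ha ih =>
    rw [Finset.sum_cons, Finset.sum_cons]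
    exact (h a (Finset.mem_cons_self a s)).add
      (ih fun i hi => h i (Finset.mem_cons_of_mem hi))

theorem mul (hT : HasDomainCommutator T A B) (hS : HasDomainCommutator S A B') :
    HasDomainCommutator (T * S) A (B * S + T * B') := by
  intro x
  obtain ⟨h2, e2⟩ := hS x
  obtain ⟨h1, e1⟩ := hT ⟨S x, h2⟩
  refine ⟨h1, e1.trans ?_⟩
  rw [e2]
  simp only [map_add, map_smul, add_apply, mul_apply_eq_comp, smul_add]
  abel

theorem hasBoundedCommutator [CompleteSpace H] (h : HasDomainCommutator T A B)
    (hA : A.IsFormalAdjoint A) (hT : IsSelfAdjoint T) : HasBoundedCommutator T A B := by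
  intro x y
  obtain ⟨hy, e⟩ := h y
  have h1 : ⟪A x, T (y : H)⟫_ℂ = ⟪(x : H), A ⟨T y, hy⟩⟫_ℂ := hA x ⟨T y, hy⟩
  have h2 : ⟪T (x : H), A y⟫_ℂ = ⟪(x : H), T (A y)⟫_ℂ := by
    conv_lhs => rw [← hT.star_eq]
    exact ContinuousLinearMap.adjoint_inner_left _ _ _
  rw [h1, h2, e, inner_add_right, inner_smul_right, sub_add_cancel_left, mul_neg, ← mul_assoc,
    Complex.I_mul_I, neg_mul, one_mul, neg_neg]

end HasDomainCommutator

/-- The Leibniz rule propagates stability under the commutator from generators to the whole algebra.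
-/
theorem exists_hasDomainCommutator_mem_adjoin {A : H →ₗ.[ℂ] H} {s : Set (H →L[ℂ] H)}
    (h : ∀ T ∈ s, ∃ B ∈ Algebra.adjoin ℂ s, HasDomainCommutator T A B) :
    ∀ T ∈ Algebra.adjoin ℂ s, ∃ B ∈ Algebra.adjoin ℂ s, HasDomainCommutator T A B := by
  intro T hT
  induction hT using Algebra.adjoin_induction with
  | mem T hT => exact h T hT
  | algebraMap c => exact ⟨0, Subalgebra.zero_mem _, .algebraMap_left c⟩
  | add T S _ _ ihT ihS =>
    obtain ⟨B, hB, hTB⟩ := ihT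
    obtain ⟨B', hB', hSB⟩ := ihS
    exact ⟨B + B', Subalgebra.add_mem _ hB hB', hTB.add hSB⟩
  | mul T S hT hS ihT ihS =>
    obtain ⟨B, hB, hTB⟩ := ihT
    obtain ⟨B', hB', hSB⟩ := ihS
    exact ⟨_, Subalgebra.add_mem _ (Subalgebra.mul_mem _ hB hS) (Subalgebra.mul_mem _ hT hB'),
      hTB.mul hSB⟩

/-! ### Regularity -/

/-- A product rule using only strong continuity of $U$: isometry carries the convergence of the
difference quotients of $y$ through the varying $U_s$. -/
theorem hasDerivAt_isometry_apply {U : ℝ → H →L[ℂ] H} (hn : ∀ t x, ‖U t x‖ = ‖x‖)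
    (hc : ∀ x, Continuous fun t => U t x) {y : ℝ → H} {y' z : H} {t : ℝ}
    (hy : HasDerivAt y y' t) (hz : HasDerivAt (fun s => U s (y t)) z t) :
    HasDerivAt (fun s => U s (y s)) (z + U t y') t := by
  have h1 : HasDerivAt (fun s => U s (y s - y t)) (U t y') t := by
    rw [hasDerivAt_iff_tendsto_slope] at hy ⊢
    have h2 : Tendsto (fun s => U s (slope y t s - y')) (𝓝[≠] t) (𝓝 0) := by
      rw [tendsto_zero_iff_norm_tendsto_zero]
      simp only [hn]
      exact tendsto_iff_norm_sub_tendsto_zero.1 hy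
    have h3 := h2.add ((hc y').continuousAt.tendsto.mono_left (nhdsWithin_le_nhds (s := {t}ᶜ)))
    rw [zero_add] at h3
    refine h3.congr fun s => ?_
    rw [map_sub, sub_add_cancel, slope_def_module, slope_def_module, sub_self, map_zero, sub_zero,
      ← Complex.coe_smul, ← Complex.coe_smul, map_smul]
  refine (hz.add h1).congr_of_eventuallyEq (Eventually.of_forall fun s => ?_)
  simp

namespace IsUnitaryGroupOf

variable [CompleteSpace H] {A : H →ₗ.[ℂ] H} {U : ℝ → H →L[ℂ] H}

theorem norm_apply (hU : IsUnitaryGroupOf A U) (t : ℝ) (x : H) : ‖U t x‖ = ‖x‖ :=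
  norm_apply_of_mem_unitary (hU.mem_unitary t) x

theorem hasDerivAt_apply (hU : IsUnitaryGroupOf A U) (t : ℝ) (x : A.domain) :
    HasDerivAt (fun s => U s x) (U t (Complex.I • A x)) t := by
  have h0 : HasDerivAt (fun s => U s x) (Complex.I • A x) (t - t) := by
    rw [sub_self]
    exact (hU.generator _ _).2 ⟨x.2, rfl⟩
  have h1 := h0.comp_sub_const t t
  have h2 := ((U t).restrictScalars ℝ).hasFDerivAt.comp_hasDerivAt t h1
  refine h2.congr_of_eventuallyEq (Eventually.of_forall fun s => ?_)
  change U s x = (U t * U (s - t)) x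
  rw [← hU.map_add, add_sub_cancel]

/-- The domain of $A$ consists exactly of the vectors whose orbit is differentiable at $0$, and
$U_t$ commutes with $U_s$. -/
theorem apply_mem (hU : IsUnitaryGroupOf A U) (t : ℝ) (x : A.domain) :
    ∃ h : U t x ∈ A.domain, A ⟨U t x, h⟩ = U t (A x) := by
  have h1 : HasDerivAt (fun s => U s (U t x)) (U t (Complex.I • A x)) 0 := by
    have h0 := ((U t).restrictScalars ℝ).hasFDerivAt.comp_hasDerivAt 0
      ((hU.generator x _).2 ⟨x.2, rfl⟩)
    refine h0.congr_of_eventuallyEq (Eventually.of_forall fun s => ?_)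
    change (U s * U t) x = (U t * U s) x
    rw [← hU.map_add, ← hU.map_add, add_comm]
  obtain ⟨h, e⟩ := (hU.generator _ _).1 h1
  refine ⟨h, ?_⟩
  rw [map_smul] at e
  exact (smul_right_injective H Complex.I_ne_zero e).symm

theorem hasDerivAt_conj_of_mem_domain (hU : IsUnitaryGroupOf A U) {T B : H →L[ℂ] H}
    (hT : HasDomainCommutator T A B) (t : ℝ) (x : A.domain) :
    HasDerivAt (fun s => U s (T (U (-s) x))) (-U t (B (U (-t) x))) t := by
  obtain ⟨h1, e1⟩ := hU.apply_mem (-t) x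
  obtain ⟨h2, e2⟩ := hT ⟨_, h1⟩
  have hy : HasDerivAt (fun s => T (U (-s) x)) (T (-U (-t) (Complex.I • A x))) t := by
    have h3 : HasDerivAt (fun s => U (-s) x) (-U (-t) (Complex.I • A x)) t := by
      have h4 := (hU.hasDerivAt_apply (-t) x).scomp t (hasDerivAt_neg t)
      rwa [neg_one_smul] at h4
    exact (T.restrictScalars ℝ).hasFDerivAt.comp_hasDerivAt t h3
  have h4 := hasDerivAt_isometry_apply hU.norm_apply hU.continuous hy
    (hU.hasDerivAt_apply t ⟨_, h2⟩)
  convert h4 using 1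
  rw [← _root_.map_add, ← map_neg, e2, e1]
  congr 1
  simp only [map_smul, map_neg, smul_add, smul_smul, Complex.I_mul_I]
  module

/-- Approximating $x$ from the domain, the derivatives converge uniformly in time, with error at
most $\|B\|\,\|x-u_n\|$ by unitarity, so the limit may be differentiated. -/
theorem hasDerivAt_conj (hU : IsUnitaryGroupOf A U) (hd : Dense (A.domain : Set H))
    {T B : H →L[ℂ] H} (hT : HasDomainCommutator T A B) (t : ℝ) (x : H) :
    HasDerivAt (fun s => U s (T (U (-s) x))) (-U t (B (U (-t) x))) t := by
  obtain ⟨u, hu, hux⟩ := mem_closure_iff_seq_limit.1 (hd x)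
  have hlim : ∀ s, Tendsto (fun n => U s (T (U (-s) (u n)))) atTop (𝓝 (U s (T (U (-s) x)))) :=
    fun s => ((U s).continuous.tendsto _).comp ((T.continuous.tendsto _).comp
      (((U (-s)).continuous.tendsto _).comp hux))
  refine hasDerivAt_of_tendstoUniformly (l := atTop) (f := fun n s => U s (T (U (-s) (u n))))
    (f' := fun n s => -U s (B (U (-s) (u n)))) (g' := fun s => -U s (B (U (-s) x)))
    ?_ (Eventually.of_forall fun n s => hU.hasDerivAt_conj_of_mem_domain hT s ⟨u n, hu n⟩)
    hlim t
  rw [Metric.tendstoUniformly_iff]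
  intro ε hε
  filter_upwards [Metric.tendsto_nhds.1 hux (ε / (‖B‖ + 1)) (by positivity)] with n hn s
  rw [lt_div_iff₀ (by positivity), dist_comm, dist_eq_norm] at hn
  rw [dist_eq_norm, neg_sub_neg, ← map_sub, ← map_sub, ← map_sub, hU.norm_apply]
  refine (B.le_opNorm _).trans_lt ?_
  rw [hU.norm_apply, norm_sub_rev]
  nlinarith [norm_nonneg (x - u n)]

theorem contDiff_conj (hU : IsUnitaryGroupOf A U) (hd : Dense (A.domain : Set H))
    {s : Set (H →L[ℂ] H)} (hs : ∀ T ∈ s, ∃ B ∈ s, HasDomainCommutator T A B) (k : ℕ) :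
    ∀ T ∈ s, ∀ x, ContDiff ℝ k fun t => U t (T (U (-t) x)) := by
  induction k with
  | zero =>
    intro T hT x
    obtain ⟨B, -, hTB⟩ := hs T hT
    exact contDiff_zero.2 (continuous_iff_continuousAt.2 fun t =>
      (hU.hasDerivAt_conj hd hTB t x).continuousAt)
  | succ k ih =>
    intro T hT x
    obtain ⟨B, hB, hTB⟩ := hs T hT
    have h := fun t => hU.hasDerivAt_conj hd hTB t x
    push_cast
    rw [contDiff_succ_iff_deriv]
    refine ⟨fun t => (h t).differentiableAt, by simp, ?_⟩
    rw [show deriv _ = _ from funext fun t => (h t).deriv]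
    exact (ih B hB x).neg

end IsUnitaryGroupOf

/-! ### Closures of symmetric operators -/

variable {A : H →ₗ.[ℂ] H}

/-- The adjoint is a closed extension. -/
theorem LinearPMap.IsFormalAdjoint.isClosable [CompleteSpace H] (hd : Dense (A.domain : Set H))
    (hA : A.IsFormalAdjoint A) : A.IsClosable :=
  (LinearPMap.adjoint_isClosed hd).isClosable.leIsClosable (hA.le_adjoint hd)

theorem LinearPMap.IsClosable.exists_seq_of_mem_closure (hA : A.IsClosable) (x : A.closure.domain) :
    ∃ u : ℕ → A.domain, Tendsto (fun n => (u n : H)) atTop (𝓝 x) ∧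
      Tendsto (fun n => A (u n)) atTop (𝓝 (A.closure x)) := by
  have h : ((x : H), A.closure x) ∈ A.graph.topologicalClosure := by
    rw [hA.graph_closure_eq_closure_graph]
    exact A.closure.mem_graph x
  obtain ⟨p, hp, hpx⟩ := mem_closure_iff_seq_limit.1 h
  choose u hu using fun n => (LinearPMap.mem_graph_iff A).1 (hp n)
  refine ⟨u, ?_, ?_⟩
  · exact ((continuous_fst.tendsto _).comp hpx).congr fun n => (hu n).1.symm
  · exact ((continuous_snd.tendsto _).comp hpx).congr fun n => (hu n).2.symm

theorem LinearPMap.IsClosable.mem_closure_of_seq (hA : A.IsClosable) {u : ℕ → A.domain} {x y : H}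
    (hx : Tendsto (fun n => (u n : H)) atTop (𝓝 x)) (hy : Tendsto (fun n => A (u n)) atTop (𝓝 y)) :
    ∃ h : x ∈ A.closure.domain, A.closure ⟨x, h⟩ = y := by
  have h : (x, y) ∈ A.closure.graph := by
    rw [← hA.graph_closure_eq_closure_graph]
    exact mem_closure_iff_seq_limit.2 ⟨fun n => ((u n : H), A (u n)), fun n => A.mem_graph _,
      hx.prodMk_nhds hy⟩
  obtain ⟨z, hz, hz'⟩ := (LinearPMap.mem_graph_iff _).1 h
  subst hz
  exact ⟨z.2, hz'⟩

theorem LinearPMap.IsFormalAdjoint.closure [CompleteSpace H] (hd : Dense (A.domain : Set H))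
    (hA : A.IsFormalAdjoint A) : A.closure.IsFormalAdjoint A.closure := by
  intro x y
  have hc := hA.isClosable hd
  obtain ⟨u, hu, hu'⟩ := hc.exists_seq_of_mem_closure x
  obtain ⟨v, hv, hv'⟩ := hc.exists_seq_of_mem_closure y
  exact tendsto_nhds_unique (hu'.inner hv) ((hu.inner hv').congr fun n => (hA (u n) (v n)).symm)

theorem HasDomainCommutator.closure (hc : A.IsClosable) {T B : H →L[ℂ] H}
    (h : HasDomainCommutator T A B) : HasDomainCommutator T A.closure B := by
  intro x
  obtain ⟨u, hu, hu'⟩ := hc.exists_seq_of_mem_closure x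
  choose hT e using h
  refine hc.mem_closure_of_seq (u := fun n => ⟨T (u n), hT (u n)⟩)
    ((T.continuous.tendsto _).comp hu) ?_
  simp only [e]
  exact ((T.continuous.tendsto _).comp hu').add
    (((B.continuous.tendsto _).comp hu).const_smul Complex.I)

theorem dense_closure_domain (hd : Dense (A.domain : Set H)) :
    Dense (A.closure.domain : Set H) :=
  hd.mono A.le_closure.1

/-- Trivial orthogonal complement means dense range; the lower bound $|a|\|x\|\le\|(a-iA)x\|$ makes
preimages of a convergent sequence Cauchy, so the closure attains every value. -/
theorem exists_closure_resolvent_eq [CompleteSpace H] (hd : Dense (A.domain : Set H))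
    (hA : A.IsFormalAdjoint A) {a : ℝ} (ha : a ≠ 0)
    (h0 : ∀ u : H, (∀ x : A.domain, ⟪(a : ℂ) • (x : H) - Complex.I • A x, u⟫_ℂ = 0) → u = 0)
    (y : H) : ∃ x : A.closure.domain, (a : ℂ) • (x : H) - Complex.I • A.closure x = y := by
  have hc := hA.isClosable hd
  let L : A.domain →ₗ[ℂ] H := (a : ℂ) • A.domain.subtype - Complex.I • A.toFun
  have hL : ∀ x : A.domain, L x = (a : ℂ) • (x : H) - Complex.I • A x := fun x => rfl
  have hdense : (LinearMap.range L).topologicalClosure = ⊤ := by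
    rw [Submodule.topologicalClosure_eq_top_iff, Submodule.eq_bot_iff]
    intro u hu
    exact h0 u fun x => (Submodule.mem_orthogonal _ _).1 hu _ ⟨x, hL x⟩
  have hy : y ∈ (LinearMap.range L).topologicalClosure := hdense ▸ Submodule.mem_top
  obtain ⟨p, hp, hpy⟩ := mem_closure_iff_seq_limit.1 hy
  choose u hu using hp
  have hcau : CauchySeq fun n => (u n : H) := by
    rw [Metric.cauchySeq_iff]
    intro ε hε
    obtain ⟨N, hN⟩ := Metric.cauchySeq_iff.1 hpy.cauchySeq (|a| * ε)
      (mul_pos (abs_pos.2 ha) hε)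
    refine ⟨N, fun m hm n hn => ?_⟩
    have h1 := hN m hm n hn
    have h2 := norm_le_norm_resolvent hA a (u m - u n)
    rw [← hL, map_sub, hu, hu, ← dist_eq_norm] at h2
    rw [dist_eq_norm]
    exact lt_of_mul_lt_mul_left (h2.trans_lt h1) (abs_nonneg a)
  obtain ⟨x, hx⟩ := cauchySeq_tendsto_of_complete hcau
  have hAu : Tendsto (fun n => A (u n)) atTop (𝓝 (-Complex.I • ((a : ℂ) • x - y))) := by
    refine (((hx.const_smul (a : ℂ)).sub hpy).const_smul (-Complex.I)).congr fun n => ?_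
    rw [← hu, hL, sub_sub_cancel, smul_smul, neg_mul, Complex.I_mul_I, neg_neg, one_smul]
  obtain ⟨h, e⟩ := hc.mem_closure_of_seq hx hAu
  refine ⟨⟨x, h⟩, ?_⟩
  rw [e, smul_smul, mul_neg, Complex.I_mul_I, neg_neg, one_smul, sub_sub_cancel]

end Regularity

/-! ### Chebyshev identity and commutators on the lattice. -/

section Lattice

open Filter Topology

variable {d : ℕ}

/-! ### Shifts and Laplacians -/

theorem shift_apply (j : Fin d) (k : ℤ) (u : LatticeL2 d) (n : Fin d → ℤ) :
    shift j k u n = u (n - Pi.single j k) := rfl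

theorem shift_zero (j : Fin d) : shift j 0 = 1 := by
  ext u n
  simp [shift_apply]

theorem shift_mul_shift (j : Fin d) (k l : ℤ) : shift j k * shift j l = shift j (k + l) := by
  ext u n
  simp only [mul_apply_eq_comp, shift_apply, Pi.single_add, sub_sub]

theorem adjoint_shift (j : Fin d) (k : ℤ) :
    ContinuousLinearMap.adjoint (shift j k) = shift j (-k) := by
  symm
  rw [ContinuousLinearMap.eq_adjoint_iff]
  intro x y
  rw [lp.inner_eq_tsum, lp.inner_eq_tsum,
    ← (Equiv.subRight (Pi.single j k : Fin d → ℤ)).tsum_eq]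
  refine tsum_congr fun n => ?_
  simp [shift_apply, Pi.single_neg]

theorem isSelfAdjoint_coordLaplacian (j : Fin d) : IsSelfAdjoint (coordLaplacian j) := by
  rw [isSelfAdjoint_iff, coordLaplacian, star_smul, star_add, ContinuousLinearMap.star_eq_adjoint,
    ContinuousLinearMap.star_eq_adjoint, adjoint_shift, adjoint_shift, neg_neg, add_comm]
  simp

theorem prodLaplacian_cons {s : Finset (Fin d)} {a : Fin d} (ha : a ∉ s) :
    prodLaplacian (Finset.cons a s ha) = coordLaplacian a * prodLaplacian s :=
  Finset.noncommProd_cons _ _ _ _ _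

theorem prodLaplacian_empty : prodLaplacian (∅ : Finset (Fin d)) = 1 :=
  Finset.noncommProd_empty _ _

theorem coordLaplacian_commute_prodLaplacian (a : Fin d) (s : Finset (Fin d)) :
    Commute (coordLaplacian a) (prodLaplacian s) :=
  Finset.noncommProd_commute _ _ _ _ fun i _ => coordLaplacian_commute a i

theorem isSelfAdjoint_prodLaplacian (s : Finset (Fin d)) : IsSelfAdjoint (prodLaplacian s) := by
  induction s using Finset.cons_induction with
  | empty => rw [prodLaplacian_empty]; exact IsSelfAdjoint.one _
  | cons a s ha ih =>
    rw [prodLaplacian_cons]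
    exact ((isSelfAdjoint_coordLaplacian a).commute_iff ih).1
      (coordLaplacian_commute_prodLaplacian a s)

/-- The algebra generated by the `Δ_j`. -/
noncomputable def laplacianAlgebra (d : ℕ) : Subalgebra ℂ (LatticeL2 d →L[ℂ] LatticeL2 d) :=
  Algebra.adjoin ℂ (Set.range coordLaplacian)

theorem coordLaplacian_mem (j : Fin d) : coordLaplacian j ∈ laplacianAlgebra d :=
  Algebra.subset_adjoin ⟨j, rfl⟩

theorem prodLaplacian_mem (s : Finset (Fin d)) : prodLaplacian s ∈ laplacianAlgebra d := by
  induction s using Finset.cons_induction with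
  | empty => rw [prodLaplacian_empty]; exact Subalgebra.one_mem _
  | cons a s ha ih =>
    rw [prodLaplacian_cons]
    exact Subalgebra.mul_mem _ (coordLaplacian_mem a) ih

theorem chebyshevLaplacian_mem (j : Fin d) (k : ℕ) : chebyshevLaplacian j k ∈ laplacianAlgebra d :=
  Subalgebra.mul_mem _
    (Subalgebra.sub_mem _ (Subalgebra.one_mem _) (Subalgebra.pow_mem _ (coordLaplacian_mem j) 2))
    (Algebra.adjoin_mono (Set.singleton_subset_iff.2 (Set.mem_range_self j))
      (Polynomial.aeval_mem_adjoin_singleton ℂ _))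

/-- With $S_j=e^{i\theta}$ this is $\sin\theta\,U_{k-1}(\cos\theta)=\sin k\theta$; both sides obey
the same three-term recurrence. -/
theorem shift_sub_shift_mul_aeval_U (j : Fin d) (k : ℕ) :
    (shift j 1 - shift j (-1)) *
      Polynomial.aeval (coordLaplacian j) (Polynomial.Chebyshev.U ℂ ((k : ℤ) - 1)) =
      shift j k - shift j (-k) := by
  induction k using Nat.twoStepInduction with
  -- Here the integer-indexed convention $U_{-1}=0$ is used.
  | zero => simp
  | one => simp
  | more k ih1 ih2 =>
    have e : Polynomial.Chebyshev.U ℂ (((k + 2 : ℕ) : ℤ) - 1) =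
        2 * Polynomial.X * Polynomial.Chebyshev.U ℂ (((k + 1 : ℕ) : ℤ) - 1) -
          Polynomial.Chebyshev.U ℂ ((k : ℤ) - 1) := by
      have h := Polynomial.Chebyshev.U_add_two ℂ ((k : ℤ) - 1)
      push_cast
      convert h using 2 <;> ring_nf
    have h2 : (2 : LatticeL2 d →L[ℂ] LatticeL2 d) * coordLaplacian j =
        shift j 1 + shift j (-1) := by
      rw [coordLaplacian, two_mul]
      module
    have h3 : (shift j 1 - shift j (-1)) * (shift j 1 + shift j (-1)) =
        (shift j 1 + shift j (-1)) * (shift j 1 - shift j (-1)) := by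
      simp only [sub_mul, add_mul, mul_sub, mul_add, shift_mul_shift]
      norm_num
      abel
    rw [e, map_sub, map_mul, map_mul, Polynomial.aeval_X, map_ofNat, h2, mul_sub, ih1,
      ← mul_assoc, h3, mul_assoc, ih2]
    simp only [add_mul, mul_sub, shift_mul_shift]
    push_cast
    ring_nf
    abel

/-- Uses $1-\Delta_j^2=-\tfrac14(S_j-S_j^{-1})^2$, the operator form of
$1-\cos^2\theta=\sin^2\theta$. -/
theorem chebyshevLaplacian_eq (j : Fin d) (k : ℕ) :
    chebyshevLaplacian j k =
      (-1 / 4 : ℂ) • ((shift j 1 - shift j (-1)) * (shift j k - shift j (-k))) := by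
  rw [chebyshevLaplacian, ← shift_sub_shift_mul_aeval_U, ← mul_assoc, ← smul_mul_assoc]
  congr 1
  rw [sq, coordLaplacian, ← shift_zero j]
  simp only [sub_mul, add_mul, mul_sub, mul_add, shift_mul_shift, smul_mul_assoc, mul_smul_comm]
  norm_num
  module

theorem chebyshevLaplacian_commute_coordLaplacian (i j : Fin d) (k : ℕ) :
    Commute (chebyshevLaplacian j k) (coordLaplacian i) := by
  have h : ∀ m : ℤ, Commute (shift j m) (coordLaplacian i) := fun m =>
    ((latticeShift_commute _ _).add_right (latticeShift_commute _ _)).smul_right _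
  rw [chebyshevLaplacian_eq]
  exact (((h _).sub_left (h _)).mul_left ((h _).sub_left (h _))).smul_left _

/-- The derivation property of `prodLaplacian`. -/
theorem hasDomainCommutator_prodLaplacian {A : LatticeL2 d →ₗ.[ℂ] LatticeL2 d} {κ : Fin d → ℕ}
    (h : ∀ j, HasDomainCommutator (coordLaplacian j) A (chebyshevLaplacian j (κ j)))
    (s : Finset (Fin d)) :
    HasDomainCommutator (prodLaplacian s) A
      (∑ j ∈ s, prodLaplacian (s.erase j) * chebyshevLaplacian j (κ j)) := by
  induction s using Finset.cons_induction with
  | empty =>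
    rw [prodLaplacian_empty, Finset.sum_empty, ← map_one (algebraMap ℂ _)]
    exact .algebraMap_left 1
  | cons a s ha ih =>
    have h1 := (h a).mul ih
    rw [← prodLaplacian_cons ha] at h1
    convert h1 using 1
    rw [Finset.sum_cons, Finset.erase_cons, Finset.mul_sum]
    congr 1
    · exact (Finset.noncommProd_commute _ _ _ _ fun i _ =>
        chebyshevLaplacian_commute_coordLaplacian i a (κ a)).symm.eq
    · refine Finset.sum_congr rfl fun j hj => ?_
      have hja : a ≠ j := fun e => ha (e ▸ hj)
      have h2 : (Finset.cons a s ha).erase j =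
          Finset.cons a (s.erase j) fun h => ha (Finset.mem_of_mem_erase h) := by
        rw [Finset.cons_eq_insert, Finset.cons_eq_insert, Finset.erase_insert_of_ne hja]
      rw [h2, prodLaplacian_cons, mul_assoc]

/-! ### The dilation operators on finitely supported sequences -/

/-- An operator on `ℓ_0(ℤ^d)`, as a densely defined operator in `ℓ²(ℤ^d)`. -/
noncomputable abbrev finSuppOperator (B : finSupp d →ₗ[ℂ] finSupp d) : LatticeL2 d →ₗ.[ℂ] LatticeL2 d :=
  ⟨finSupp d, (finSupp d).subtype ∘ₗ B⟩

theorem single_mem_finSupp (n : Fin d → ℤ) (c : ℂ) :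
    (lp.single 2 n c : LatticeL2 d) ∈ finSupp d :=
  (Set.finite_singleton n).subset fun m hm => by
    by_contra h
    exact hm (by simpa using Pi.single_eq_of_ne (M := fun _ => ℂ) h c)

theorem dense_finSupp : Dense (finSupp d : Set (LatticeL2 d)) := by
  intro u
  have h := lp.hasSum_single (p := 2) (by norm_num) u
  exact mem_closure_of_tendsto h
    (Eventually.of_forall fun s => (finSupp d).sum_mem fun n _ => single_mem_finSupp n _)

theorem dilation₀_apply (j : Fin d) (k : ℕ) (u : finSupp d) (n : Fin d → ℤ) :
    (dilation₀ j k u).1 n = 1 / (4 * Complex.I) *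
      ((2 * n j - k) * u.1 (n - Pi.single j (k : ℤ)) -
        (2 * n j + k) * u.1 (n + Pi.single j (k : ℤ))) := by
  have h : (dilation₀ j k u).1 n = 1 / (4 * Complex.I) *
      (((((n - Pi.single j (k : ℤ) : Fin d → ℤ) j : ℤ) : ℂ) * u.1 (n - Pi.single j (k : ℤ)) -
        (((n - Pi.single j (-(k : ℤ)) : Fin d → ℤ) j : ℤ) : ℂ) * u.1 (n - Pi.single j (-(k : ℤ)))) +
        (n j : ℤ) * (u.1 (n - Pi.single j (k : ℤ)) - u.1 (n - Pi.single j (-(k : ℤ))))) := rfl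
  rw [h, Pi.single_neg, sub_neg_eq_add]
  simp only [Pi.sub_apply, Pi.add_apply, Pi.single_eq_same]
  push_cast
  ring

theorem inner_position₀ (j : Fin d) (u w : finSupp d) :
    ⟪(position₀ j u : LatticeL2 d), (w : LatticeL2 d)⟫_ℂ =
      ⟪(u : LatticeL2 d), (position₀ j w : LatticeL2 d)⟫_ℂ := by
  rw [lp.inner_eq_tsum, lp.inner_eq_tsum]
  refine tsum_congr fun n => ?_
  change ⟪(n j : ℂ) * u.1 n, w.1 n⟫_ℂ = ⟪u.1 n, (n j : ℂ) * w.1 n⟫_ℂ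
  simp only [RCLike.inner_apply, map_mul, map_intCast]
  ring

theorem inner_shift₀ (j : Fin d) (k : ℤ) (u w : finSupp d) :
    ⟪(shift₀ j k u : LatticeL2 d), (w : LatticeL2 d)⟫_ℂ =
      ⟪(u : LatticeL2 d), (shift₀ j (-k) w : LatticeL2 d)⟫_ℂ := by
  change ⟪shift j k u.1, w.1⟫_ℂ = ⟪u.1, shift j (-k) w.1⟫_ℂ
  rw [← adjoint_shift, ContinuousLinearMap.adjoint_inner_right]

/-- $S^k-S^{-k}$ is antisymmetric and $N_j$ symmetric, so their anticommutator is antisymmetric; the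
imaginary factor $1/(4i)$ restores symmetry. -/
theorem inner_dilation₀ (j : Fin d) (k : ℕ) (u w : finSupp d) :
    ⟪(dilation₀ j k u : LatticeL2 d), (w : LatticeL2 d)⟫_ℂ =
      ⟪(u : LatticeL2 d), (dilation₀ j k w : LatticeL2 d)⟫_ℂ := by
  simp only [dilation₀, LinearMap.smul_apply, LinearMap.add_apply, LinearMap.comp_apply,
    LinearMap.sub_apply, map_sub, Submodule.coe_smul, Submodule.coe_add, Submodule.coe_sub,
    inner_smul_left, inner_smul_right, inner_add_left, inner_add_right, inner_sub_left,
    inner_sub_right, inner_shift₀, inner_position₀, neg_neg, map_div₀, map_mul, map_one,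
    Complex.conj_I, map_ofNat]
  ring

theorem isFormalAdjoint_dilation₀ (j : Fin d) (k : ℕ) :
    (finSuppOperator (dilation₀ j k)).IsFormalAdjoint (finSuppOperator (dilation₀ j k)) :=
  fun u w => inner_dilation₀ j k u w

theorem isFormalAdjoint_sum_dilation₀ (κ : Fin d → ℕ) :
    (finSuppOperator (∑ j, dilation₀ j (κ j))).IsFormalAdjoint
      (finSuppOperator (∑ j, dilation₀ j (κ j))) := by
  intro u w
  change ⟪(((∑ j, dilation₀ j (κ j)) u : finSupp d) : LatticeL2 d), (w : LatticeL2 d)⟫_ℂ =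
    ⟪(u : LatticeL2 d), (((∑ j, dilation₀ j (κ j)) w : finSupp d) : LatticeL2 d)⟫_ℂ
  simp only [LinearMap.sum_apply, Submodule.coe_sum, sum_inner, inner_sum, inner_dilation₀]

theorem coordLaplacian_apply (i : Fin d) (u : LatticeL2 d) (n : Fin d → ℤ) :
    coordLaplacian i u n = 1 / 2 * (u (n - Pi.single i 1) + u (n + Pi.single i 1)) := by
  have h : coordLaplacian i u n =
    1 / 2 * (u (n - Pi.single i 1) + u (n - Pi.single i (-1))) := rfl
  rw [h, Pi.single_neg, sub_neg_eq_add]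

theorem coordLaplacian_mem_finSupp (i : Fin d) (u : finSupp d) :
    coordLaplacian i (u : LatticeL2 d) ∈ finSupp d :=
  (finSupp d).smul_mem _
    ((finSupp d).add_mem (shift_mem_finSupp i 1 u u.2) (shift_mem_finSupp i (-1) u u.2))

theorem chebyshevLaplacian_apply (j : Fin d) (k : ℕ) (u : LatticeL2 d) (n : Fin d → ℤ) :
    chebyshevLaplacian j k u n = -1 / 4 *
      (u (n - Pi.single j 1 - Pi.single j (k : ℤ)) - u (n - Pi.single j 1 + Pi.single j (k : ℤ)) -
        (u (n + Pi.single j 1 - Pi.single j (k : ℤ)) -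
          u (n + Pi.single j 1 + Pi.single j (k : ℤ)))) := by
  rw [chebyshevLaplacian_eq]
  have h : ((-1 / 4 : ℂ) • ((shift j 1 - shift j (-1)) * (shift j k - shift j (-k)))) u n =
    -1 / 4 * (u (n - Pi.single j 1 - Pi.single j (k : ℤ)) -
        u (n - Pi.single j 1 - Pi.single j (-(k : ℤ))) -
        (u (n - Pi.single j (-1) - Pi.single j (k : ℤ)) -
          u (n - Pi.single j (-1) - Pi.single j (-(k : ℤ))))) := rfl
  simp only [h, Pi.single_neg, sub_neg_eq_add]

/-- All shifts commute, so only the change of the coefficient $n_j$ under $n\mapsto n\pm e_i$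
survives, and it is zero unless $i=j$. -/
theorem dilation₀_coordLaplacian_apply (i j : Fin d) (k : ℕ) (u : finSupp d) :
    (dilation₀ j k ⟨coordLaplacian i u.1, coordLaplacian_mem_finSupp i u⟩).1 =
      coordLaplacian i (dilation₀ j k u).1 +
        Complex.I • (if j = i then chebyshevLaplacian j k else 0) u.1 := by
  ext n
  change _ = coordLaplacian i (dilation₀ j k u).1 n +
    Complex.I * (if j = i then chebyshevLaplacian j k else 0) u.1 n
  have hI : 1 / (4 * Complex.I) = -Complex.I / 4 := by
    field_simp
    simp
  rw [dilation₀_apply, coordLaplacian_apply, coordLaplacian_apply, coordLaplacian_apply,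
    dilation₀_apply, dilation₀_apply, hI]
  set e : Fin d → ℤ := Pi.single i 1 with he
  set v : Fin d → ℤ := Pi.single j (k : ℤ) with hv
  rw [sub_right_comm n v e, show n - v + e = n + e - v by abel, show n + v - e = n - e + v by abel,
    add_right_comm n v e]
  split_ifs with h
  · subst h
    rw [chebyshevLaplacian_apply, ← he, ← hv]
    simp only [Pi.sub_apply, Pi.add_apply, he, Pi.single_eq_same]
    push_cast
    ring
  · simp only [Pi.sub_apply, Pi.add_apply, he, Pi.single_eq_of_ne h]
    change _ = _ + Complex.I * 0
    push_cast
    ring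

theorem hasDomainCommutator_dilation₀ (j : Fin d) (k : ℕ) :
    HasDomainCommutator (coordLaplacian j) (finSuppOperator (dilation₀ j k))
      (chebyshevLaplacian j k) := by
  intro u
  refine ⟨coordLaplacian_mem_finSupp j u, (dilation₀_coordLaplacian_apply j j k u).trans ?_⟩
  rw [if_pos rfl]
  rfl

theorem hasDomainCommutator_sum_dilation₀ (κ : Fin d → ℕ) (i : Fin d) :
    HasDomainCommutator (coordLaplacian i) (finSuppOperator (∑ j, dilation₀ j (κ j)))
      (chebyshevLaplacian i (κ i)) := by
  intro u
  refine ⟨coordLaplacian_mem_finSupp i u, ?_⟩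
  change (((∑ j, dilation₀ j (κ j)) ⟨coordLaplacian i u.1, coordLaplacian_mem_finSupp i u⟩ :
    finSupp d) : LatticeL2 d) = coordLaplacian i (((∑ j, dilation₀ j (κ j)) u : finSupp d) :
      LatticeL2 d) + Complex.I • chebyshevLaplacian i (κ i) u.1
  simp only [LinearMap.sum_apply, Submodule.coe_sum, dilation₀_coordLaplacian_apply,
    Finset.sum_add_distrib, map_sum, ← Finset.smul_sum]
  congr 2
  rw [← sum_apply]
  simp

end Lattice

/-! ### Weighted estimate, vanishing of the deficiency spaces, conclusion. -/

section Deficiency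

open Filter Topology

/-! ### Weighted estimate and deficiency spaces -/

theorem abs_re_mul_conj_le (x y : ℂ) :
    |(x * (starRingEnd ℂ) y).re| ≤ (‖x‖ ^ 2 + ‖y‖ ^ 2) / 2 := by
  refine (Complex.abs_re_le_norm _).trans ?_
  rw [norm_mul, RCLike.norm_conj]
  nlinarith [sq_nonneg (‖x‖ - ‖y‖)]

/-- The weights `w` are tempered by the coefficients `b` along `v`, with constant `C`. -/
structure IsTemperedWeight {X : Type*} [Add X] (w b : X → ℝ) (v : X) (C : ℝ) : Prop where
  nonneg : 0 ≤ C
  mul_le : ∀ n, |w n * b n| ≤ C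
  shift_mul_le : ∀ n, |w (n + v) * b n| ≤ C
  sub_mul_le : ∀ n, |(w n - w (n + v)) * b n| ≤ C * w n
  sub_mul_le_shift : ∀ n, |(w n - w (n + v)) * b n| ≤ C * w (n + v)

theorem Summable.comp_add_right {X : Type*} [AddCommGroup X] {f : X → ℝ} (hf : Summable f) (v : X) :
    Summable fun n => f (n + v) :=
  (Equiv.addRight v).summable_iff.2 hf

/-- Since $wb$ is bounded, the two parts are summable separately. Translating the second by $v$
leaves $(w(n)-w(n+v))b(n)\,\mathrm{Re}(u(n)\overline{u(n+v)})$. After $|xy|\le(|x|^2+|y|^2)/2$, each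
square is paired with the weight at its own site. -/
theorem IsTemperedWeight.exists_hasSum {X : Type*} [AddCommGroup X] {w b : X → ℝ} {v : X} {C : ℝ}
    {u : X → ℂ} (h : IsTemperedWeight w b v C)
    (hu : Summable fun n => ‖u n‖ ^ 2) (hwu : Summable fun n => w n * ‖u n‖ ^ 2) :
    ∃ σ : ℝ, HasSum (fun n => w n * (b n * (u n * (starRingEnd ℂ) (u (n + v))).re -
        b (n - v) * (u (n - v) * (starRingEnd ℂ) (u n)).re)) σ ∧
      |σ| ≤ C * ∑' n, w n * ‖u n‖ ^ 2 := by
  set r : X → ℝ := fun n => (u n * (starRingEnd ℂ) (u (n + v))).re with hr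
  have hrle : ∀ n, |r n| ≤ (‖u n‖ ^ 2 + ‖u (n + v)‖ ^ 2) / 2 := fun n => abs_re_mul_conj_le _ _
  have hs : Summable fun n => C * ((‖u n‖ ^ 2 + ‖u (n + v)‖ ^ 2) / 2) :=
    ((hu.add (hu.comp_add_right v)).div_const 2).mul_left C
  have hf : Summable fun n => w n * b n * r n := by
    refine Summable.of_norm_bounded hs fun n => ?_
    rw [Real.norm_eq_abs, abs_mul]
    exact mul_le_mul (h.mul_le n) (hrle n) (abs_nonneg _) h.nonneg
  have hg : Summable fun n => w (n + v) * b n * r n := by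
    refine Summable.of_norm_bounded hs fun n => ?_
    rw [Real.norm_eq_abs, abs_mul]
    exact mul_le_mul (h.shift_mul_le n) (hrle n) (abs_nonneg _) h.nonneg
  have hg' := (Equiv.subRight v).hasSum_iff.2 hg.hasSum
  refine ⟨_, (hf.hasSum.sub hg').congr_fun fun n => ?_, ?_⟩
  · simp only [Function.comp_apply, Equiv.subRight_apply, hr, sub_add_cancel]
    ring
  · have hwu' := (Equiv.addRight v).hasSum_iff.2 hwu.hasSum
    have hb := ((hwu.hasSum.add hwu').div_const 2).mul_left C
    rw [add_self_div_two] at hb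
    refine (hf.hasSum.sub hg.hasSum).norm_le_of_bounded hb fun n => ?_
    have h1 := h.sub_mul_le n
    have h2 := h.sub_mul_le_shift n
    have h3 : |(w n - w (n + v)) * b n| * |r n| ≤
        |(w n - w (n + v)) * b n| * ((‖u n‖ ^ 2 + ‖u (n + v)‖ ^ 2) / 2) :=
      mul_le_mul_of_nonneg_left (hrle n) (abs_nonneg _)
    rw [← sub_mul, ← sub_mul, Real.norm_eq_abs, abs_mul]
    simp only [Function.comp_apply, Equiv.coe_addRight]
    nlinarith [sq_nonneg ‖u n‖, sq_nonneg ‖u (n + v)‖,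
      mul_le_mul_of_nonneg_right h1 (sq_nonneg ‖u n‖),
      mul_le_mul_of_nonneg_right h2 (sq_nonneg ‖u (n + v)‖)]

theorem eq_zero_of_eq_sum_shift {ι X : Type*} [Fintype ι] [AddCommGroup X] {w : X → ℝ}
    {b : ι → X → ℝ} {v : ι → X} {C : ι → ℝ} {u : X → ℂ} (hw : ∀ n, 0 < w n) (hw1 : ∀ n, w n ≤ 1)
    (h : ∀ j, IsTemperedWeight w (b j) (v j) (C j)) (hu : Summable fun n => ‖u n‖ ^ 2)
    {a : ℝ} (ha : ∑ j, C j < |a|)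
    (e : ∀ n, (a : ℂ) * u n = ∑ j, (b j n * u (n + v j) - b j (n - v j) * u (n - v j))) (n : X) :
    u n = 0 := by
  have hwu : Summable fun n => w n * ‖u n‖ ^ 2 :=
    Summable.of_nonneg_of_le (fun n => mul_nonneg (hw n).le (sq_nonneg _))
      (fun n => mul_le_of_le_one_left (sq_nonneg _) (hw1 n)) hu
  choose σ hσ hσ' using fun j => (h j).exists_hasSum hu hwu
  have h1 := hasSum_sum fun j (_ : j ∈ Finset.univ) => hσ j
  have h2 : HasSum (fun n => a * (w n * ‖u n‖ ^ 2)) (∑ j, σ j) := by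
    refine h1.congr_fun fun n => ?_
    have h3 := congrArg (fun z => (z * (starRingEnd ℂ) (u n)).re) (e n)
    simp only [mul_assoc, Complex.mul_conj, Finset.sum_mul, sub_mul, Complex.re_sum,
      Complex.sub_re, Complex.re_ofReal_mul, Complex.ofReal_re, Complex.normSq_eq_norm_sq] at h3
    rw [← Finset.mul_sum, mul_left_comm, h3]
    congr 1
    refine Finset.sum_congr rfl fun j _ => ?_
    congr 2
    rw [← Complex.conj_re, map_mul, Complex.conj_conj, mul_comm]
  have h3 := h2.unique (hwu.hasSum.mul_left a)
  have h4 : |a| * ∑' n, w n * ‖u n‖ ^ 2 ≤ (∑ j, C j) * ∑' n, w n * ‖u n‖ ^ 2 := by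
    rw [← abs_of_nonneg (tsum_nonneg fun n => mul_nonneg (hw n).le (sq_nonneg ‖u n‖)), ← abs_mul,
      ← h3, abs_of_nonneg (tsum_nonneg fun n => mul_nonneg (hw n).le (sq_nonneg ‖u n‖)),
      Finset.sum_mul]
    exact (Finset.abs_sum_le_sum_abs _ _).trans (Finset.sum_le_sum fun j _ => hσ' j)
  have h5 : ∑' n, w n * ‖u n‖ ^ 2 ≤ 0 := by
    by_contra! h6
    exact absurd (le_of_mul_le_mul_right h4 h6) (not_le.2 ha)
  have h6 := (hwu.le_tsum n fun m _ => mul_nonneg (hw m).le (sq_nonneg _)).trans h5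
  have h7 : ‖u n‖ ^ 2 ≤ 0 := nonpos_of_mul_nonpos_right h6 (hw n)
  exact norm_eq_zero.1 (pow_eq_zero_iff two_ne_zero |>.1 (le_antisymm h7 (sq_nonneg _)))

variable {d : ℕ}

/-- The weight `(1 + |n|₁)⁻¹` on `ℤ^d`. -/
noncomputable def latticeWeight (n : Fin d → ℤ) : ℝ := (1 + ∑ i, |(n i : ℝ)|)⁻¹

/-- `(2 n_j + k) / 4`. -/
noncomputable def dilationCoeff (j : Fin d) (k : ℕ) (n : Fin d → ℤ) : ℝ := (2 * n j + k) / 4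

/-- With $\rho=1/w$, $|b|\le(1+k)\rho$ at both $n$ and $n+v$, while $\rho$ varies by at most $k$
along $v$. The constant $(1+k)^2$ dominates both $1+k$ and $k(1+k)$. -/
theorem isTemperedWeight_latticeWeight (j : Fin d) (k : ℕ) :
    IsTemperedWeight latticeWeight (dilationCoeff j k) (Pi.single j (k : ℤ)) ((1 + k : ℝ) ^ 2) := by
  set ρ : (Fin d → ℤ) → ℝ := fun n => 1 + ∑ i, |(n i : ℝ)| with hρ
  have hk : (0 : ℝ) ≤ k := k.cast_nonneg
  have hle : ∀ (n : Fin d → ℤ), |(n j : ℝ)| ≤ ρ n - 1 := fun n => by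
    rw [hρ, add_sub_cancel_left]
    exact Finset.single_le_sum (f := fun i => |(n i : ℝ)|) (fun i _ => abs_nonneg _)
      (Finset.mem_univ j)
  have hρ1 : ∀ n, 1 ≤ ρ n := fun n =>
    le_add_of_nonneg_right (Finset.sum_nonneg fun i _ => abs_nonneg _)
  have hρ0 : ∀ n, 0 < ρ n := fun n => zero_lt_one.trans_le (hρ1 n)
  have hρv : ∀ n, |ρ (n + Pi.single j (k : ℤ)) - ρ n| ≤ k := fun n => by
    rw [hρ, add_sub_add_left_eq_sub, ← Finset.sum_sub_distrib,
      Finset.sum_eq_single j (fun i _ hi => by simp [Pi.single_eq_of_ne hi])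
        (fun h => absurd (Finset.mem_univ j) h)]
    refine (abs_abs_sub_abs_le_abs_sub _ _).trans ?_
    simp
  have hb : ∀ n, |dilationCoeff j k n| ≤ (1 + k) * ρ n := fun n => by
    have h1 := abs_le.1 (hle n)
    have h2 := hρ1 n
    rw [dilationCoeff, abs_le]
    constructor <;> nlinarith
  have hbv : ∀ n, |dilationCoeff j k n| ≤ (1 + k) * ρ (n + Pi.single j (k : ℤ)) := fun n => by
    have h1 := abs_le.1 (hle (n + Pi.single j (k : ℤ)))
    have h2 := hρ1 (n + Pi.single j (k : ℤ))
    simp only [Pi.add_apply, Pi.single_eq_same] at h1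
    push_cast at h1
    rw [dilationCoeff, abs_le]
    constructor <;> nlinarith
  have hw : ∀ n, latticeWeight n = (ρ n)⁻¹ := fun n => rfl
  have hkC : 1 + (k : ℝ) ≤ (1 + k) ^ 2 := by nlinarith
  have hsub : ∀ n, |(ρ n)⁻¹ - (ρ (n + Pi.single j (k : ℤ)))⁻¹| ≤
      k * (ρ n)⁻¹ * (ρ (n + Pi.single j (k : ℤ)))⁻¹ := fun n => by
    rw [inv_sub_inv (hρ0 _).ne' (hρ0 _).ne', abs_div, abs_of_pos (mul_pos (hρ0 _) (hρ0 _)),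
      mul_assoc, ← mul_inv, ← div_eq_mul_inv]
    exact div_le_div_of_nonneg_right (hρv n) (mul_pos (hρ0 _) (hρ0 _)).le
  refine ⟨by positivity, fun n => ?_, fun n => ?_, fun n => ?_, fun n => ?_⟩
  · rw [hw, abs_mul, abs_of_pos (inv_pos.2 (hρ0 n)), inv_mul_le_iff₀ (hρ0 n)]
    nlinarith [hb n, hρ0 n]
  · rw [hw, abs_mul, abs_of_pos (inv_pos.2 (hρ0 _)), inv_mul_le_iff₀ (hρ0 _)]
    nlinarith [hbv n, hρ0 (n + Pi.single j (k : ℤ))]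
  · rw [hw, hw, abs_mul]
    have h1 := mul_le_mul (hsub n) (hbv n) (abs_nonneg _)
      (mul_nonneg (mul_nonneg hk (inv_pos.2 (hρ0 _)).le) (inv_pos.2 (hρ0 _)).le)
    refine h1.trans ?_
    have h2 : k * (ρ n)⁻¹ * (ρ (n + Pi.single j (k : ℤ)))⁻¹ *
        ((1 + k) * ρ (n + Pi.single j (k : ℤ))) = k * (1 + k) * (ρ n)⁻¹ := by
      field_simp [(hρ0 (n + Pi.single j (k : ℤ))).ne']
    rw [h2]
    exact mul_le_mul_of_nonneg_right (by nlinarith) (inv_pos.2 (hρ0 _)).le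
  · rw [hw, hw, abs_mul]
    have h1 := mul_le_mul (hsub n) (hb n) (abs_nonneg _)
      (mul_nonneg (mul_nonneg hk (inv_pos.2 (hρ0 _)).le) (inv_pos.2 (hρ0 _)).le)
    refine h1.trans ?_
    have h2 : k * (ρ n)⁻¹ * (ρ (n + Pi.single j (k : ℤ)))⁻¹ * ((1 + k) * ρ n) =
        k * (1 + k) * (ρ (n + Pi.single j (k : ℤ)))⁻¹ := by
      field_simp [(hρ0 n).ne']
    rw [h2]
    exact mul_le_mul_of_nonneg_right (by nlinarith) (inv_pos.2 (hρ0 _)).le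

theorem I_smul_dilation₀_single (j : Fin d) (k : ℕ) (n : Fin d → ℤ) :
    Complex.I • (dilation₀ j k ⟨lp.single 2 n 1, single_mem_finSupp n 1⟩ : LatticeL2 d) =
      (dilationCoeff j k n : ℂ) • lp.single 2 (n + Pi.single j (k : ℤ)) 1 -
        (dilationCoeff j k (n - Pi.single j (k : ℤ)) : ℂ) •
          lp.single 2 (n - Pi.single j (k : ℤ)) 1 := by
  ext m
  have hI : Complex.I * (1 / (4 * Complex.I)) = 1 / 4 := by
    field_simp
  change Complex.I * (dilation₀ j k ⟨lp.single 2 n 1, single_mem_finSupp n 1⟩).1 m =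
    (dilationCoeff j k n : ℂ) * (lp.single 2 (n + Pi.single j (k : ℤ)) (1 : ℂ) : LatticeL2 d) m -
      (dilationCoeff j k (n - Pi.single j (k : ℤ)) : ℂ) *
        (lp.single 2 (n - Pi.single j (k : ℤ)) (1 : ℂ) : LatticeL2 d) m
  rw [dilation₀_apply, ← mul_assoc, hI]
  simp only [lp.coeFn_single, Pi.single_apply (M := ℂ), dilationCoeff,
    sub_eq_iff_eq_add, eq_sub_iff_add_eq]
  -- On the support of each delta, $n_j$ is $m_j\mp k$.
  have h1 : (if m = n + Pi.single j (k : ℤ) then (1 : ℂ) else 0) * n j =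
      (if m = n + Pi.single j (k : ℤ) then (1 : ℂ) else 0) * (m j - k) := by
    split_ifs with h
    · simp [h]
    · simp
  have h2 : (if m + Pi.single j (k : ℤ) = n then (1 : ℂ) else 0) * n j =
      (if m + Pi.single j (k : ℤ) = n then (1 : ℂ) else 0) * (m j + k) := by
    split_ifs with h
    · simp [← h]
    · simp
  simp only [Pi.sub_apply, Pi.single_eq_same]
  push_cast
  linear_combination (-1 / 2 : ℂ) * h1 + (1 / 2 : ℂ) * h2

theorem eq_zero_of_orthogonal_range (κ : Fin d → ℕ) {a : ℝ}
    (ha : ∑ j, (1 + κ j : ℝ) ^ 2 < |a|) (u : LatticeL2 d)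
    (hu : ∀ x : (finSuppOperator (∑ j, dilation₀ j (κ j))).domain,
      ⟪(a : ℂ) • (x : LatticeL2 d) -
        Complex.I • finSuppOperator (∑ j, dilation₀ j (κ j)) x, u⟫_ℂ = 0) : u = 0 := by
  have hs : Summable fun n => ‖u n‖ ^ 2 := by
    simpa using (memℓp_gen_iff (p := 2) (by norm_num)).1 (lp.memℓp u)
  ext n
  refine eq_zero_of_eq_sum_shift (w := latticeWeight) (fun n => ?_) (fun n => ?_)
    (fun j => isTemperedWeight_latticeWeight j (κ j)) hs ha (fun n => ?_) n
  · have : 0 ≤ ∑ i, |(n i : ℝ)| := Finset.sum_nonneg fun i _ => abs_nonneg _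
    rw [latticeWeight]
    positivity
  · exact inv_le_one_of_one_le₀
      (le_add_of_nonneg_right (Finset.sum_nonneg fun i _ => abs_nonneg _))
  -- Testing orthogonality on the delta at $n$ gives the recursion for $u$ at $n$.
  · have h := hu ⟨lp.single 2 n 1, single_mem_finSupp n 1⟩
    change ⟪(a : ℂ) • (lp.single 2 n 1 : LatticeL2 d) - Complex.I •
      (((∑ j, dilation₀ j (κ j)) ⟨lp.single 2 n 1, single_mem_finSupp n 1⟩ : finSupp d) :
        LatticeL2 d), u⟫_ℂ = 0 at h
    rw [LinearMap.sum_apply, Submodule.coe_sum, Finset.smul_sum] at h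
    simp only [I_smul_dilation₀_single, inner_sub_left, sum_inner, inner_smul_left,
      lp.inner_single_left, Complex.conj_ofReal] at h
    simpa using sub_eq_zero.1 h

/-! ### The conjugate operator and the main theorem -/

theorem isUnitaryGroupOf_dilation (κ : Fin d → ℕ) : ∃ U, IsUnitaryGroupOf (dilation κ) U := by
  have hd : Dense ((finSuppOperator (∑ j, dilation₀ j (κ j))).domain : Set (LatticeL2 d)) :=
    dense_finSupp
  have hA := isFormalAdjoint_sum_dilation₀ κ
  refine exists_isUnitaryGroupOf (dense_closure_domain hd) (hA.closure hd)
    -- The extra $1$ makes the bound on $|a|$ strict and forces $a\ne0$ even for an empty sum.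
    (∑ j, (1 + κ j : ℝ) ^ 2 + 1) fun a ha => ?_
  have h0 : (0 : ℝ) ≤ ∑ j, (1 + κ j : ℝ) ^ 2 := Finset.sum_nonneg fun j _ => sq_nonneg _
  exact exists_closure_resolvent_eq hd hA (abs_pos.1 (by linarith))
    (eq_zero_of_orthogonal_range κ (by linarith))

theorem hasDomainCommutator_dilation (κ : Fin d → ℕ) (i : Fin d) :
    HasDomainCommutator (coordLaplacian i) (dilation κ) (chebyshevLaplacian i (κ i)) :=
  (hasDomainCommutator_sum_dilation₀ κ i).closure
    ((isFormalAdjoint_sum_dilation₀ κ).isClosable dense_finSupp)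

theorem isOfClassCInfty_of_mem (κ : Fin d → ℕ) {T : LatticeL2 d →L[ℂ] LatticeL2 d}
    (hT : T ∈ laplacianAlgebra d) : IsOfClassCInfty (dilation κ) T := by
  intro k
  obtain ⟨U, hU⟩ := isUnitaryGroupOf_dilation κ
  refine ⟨U, hU, hU.contDiff_conj (dense_closure_domain dense_finSupp)
    (s := laplacianAlgebra d) (exists_hasDomainCommutator_mem_adjoin ?_) k T hT⟩
  rintro _ ⟨j, rfl⟩
  exact ⟨_, chebyshevLaplacian_mem j (κ j), hasDomainCommutator_dilation κ j⟩

end Deficiency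

theorem mainTheorem7 (d : ℕ) (κ : Fin d → ℕ) (hκ : ∀ j, 1 ≤ κ j) :
    ((∀ j : Fin d, IsOfClassCInfty (dilation κ) (coordLaplacian j)) ∧
      IsOfClassCInfty (dilation κ) (stdLaplacian d) ∧
      IsOfClassCInfty (dilation κ) (mvLaplacian d)) ∧
    (∀ j : Fin d,
      HasBoundedCommutator (coordLaplacian j) (coordDilation κ j) (chebyshevLaplacian j (κ j))) ∧
    HasBoundedCommutator (stdLaplacian d) (dilation κ) (∑ j, chebyshevLaplacian j (κ j)) ∧
    HasBoundedCommutator (mvLaplacian d) (dilation κ)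
      (∑ j, mvQuotient j * chebyshevLaplacian j (κ j)) := by
  have hA : (dilation κ).IsFormalAdjoint (dilation κ) :=
    (isFormalAdjoint_sum_dilation₀ κ).closure dense_finSupp
  refine ⟨⟨fun j => isOfClassCInfty_of_mem κ (coordLaplacian_mem j),
    isOfClassCInfty_of_mem κ (Subalgebra.sum_mem _ fun j _ => coordLaplacian_mem j),
    isOfClassCInfty_of_mem κ (prodLaplacian_mem _)⟩, fun j => ?_, ?_, ?_⟩
  · have hj := isFormalAdjoint_dilation₀ j (κ j)
    exact ((hasDomainCommutator_dilation₀ j (κ j)).closure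
      (hj.isClosable dense_finSupp)).hasBoundedCommutator (hj.closure dense_finSupp)
      (isSelfAdjoint_coordLaplacian j)
  · exact (HasDomainCommutator.sum fun j _ => hasDomainCommutator_dilation κ j).hasBoundedCommutator
      hA (isSelfAdjoint_sum _ fun j _ => isSelfAdjoint_coordLaplacian j)
  · exact (hasDomainCommutator_prodLaplacian (hasDomainCommutator_dilation κ)
      Finset.univ).hasBoundedCommutator hA (isSelfAdjoint_prodLaplacian _)
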